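/- **Setting.** Let $\mathbb F$ be a finite field. An $[n,k,\alpha]$ vector code is given by an injective $\mathbb F$-linear encoding of $k$ message symbols into $n$ code symbols, each symbol being a vector of $\alpha$ subsymbols in $\mathbb F$; it is MDS if its minimum distance (counted in symbols) is $n-k+1$, and scalar if $\alpha=1$. Let $k^I\ge 1$, $\varsigma\ge 2$, $r^I,r^F\ge 0$, $n^I=k^I+r^I$, $n^F=\varsigma k^I+r^F$. An $(n^I,k^I;n^F,\varsigma k^I)$ convertible code (merge regime) consists of an $[n^I,k^I,\alpha]$ initial code, an $[n^F,\varsigma k^I,\alpha]$ final code, a partition of the $\varsigma k^I$ message symbols into $\varsigma$ blocks of size $k^I$ (block $s$ is encoded as initial codeword $s$), and a conversion procedure: some initial nodes are kept unchanged as nodes of the final codeword, the others are retired; from each initial node $x$ a function of its content consisting of $\beta(x)\le\alpha$ subsymbols is downloaded; and the contents of the remaining (new) nodes of the final codeword are computed from the downloaded data. It is MDS if both codes are. Its conversion bandwidth is $\gamma=\sum_x\beta(x)+\alpha\cdot\#\{\text{new nodes}\}$, its access cost is $\#\{x:\beta(x)>0\}+\#\{\text{new nodes}\}$. A scalar MDS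 convertible code is access-optimal if its access cost is minimum among all scalar MDS convertible codes with the same parameters over all finite fields. Put $$\gamma^*(\alpha)=\begin{cases}\varsigma\alpha\min\{k^I,r^F\}+r^F\alpha,& r^F\le r^I\ \text{or}\ k^I\le r^F,\\[2pt] \varsigma\alpha\Bigl(r^I+k^I\bigl(1-\tfrac{r^I}{r^F}\bigr)\Bigr)+r^F\alpha,&\text{otherwise.}\end{cases}$$ **Theorem.** 1. (*Piggybacked code.*) Let $r^I<r^F<k^I$. Let an access-optimal $(k^I+r^F,k^I;n^F,\varsigma k^I)$ convertible code be given whose initial and final codes are systematic and whose conversion reads only parity nodes, and let $p^I_i$, $p^F_i$ $(1\le i\le r^F)$ be the encoding vectors of the parities of its initial and final code. Take $\alpha=r^F$, and write $m_j$ for the vector of $j$-th coordinates of a message. Let the new initial code $\mathcal C^I$ be the systematic $[n^I,k^I,\alpha]$ code whose parity $i\in\{1,\dots,r^I\}$ has $j$-th coordinate $m_jp^I_i$ for $j\le r^I$ and $m_jp^I_i+m_ip^I_j$ for $r^I<j\le r^F$ (the last $r^F-r^I$ parities of the base code are punctured and used as piggybacks), and let the new final code $\mathcal C^F$ consist of $r^F$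 instances of the base final code, i.e. it is systematic with parities $m_jp^F_i$, $1\le i,j\le r^F$. Then, with the same partition, $(\mathcal C^I,\mathcal C^F)$ is an MDS $(n^I,k^I;n^F,\varsigma k^I)$ convertible code with a linear conversion procedure in which all systematic initial nodes are unchanged and all initial parity nodes are retired, which downloads all $r^F$ subsymbols of each retired node and exactly the $r^F-r^I$ subsymbols with coordinates $r^I<j\le r^F$ of each unchanged node, and whose conversion bandwidth is $\gamma=\gamma^*(r^F)$. 2. (*Explicit base codes.*) Let $r^I<r^F<k^I$. For every prime $p$, every $D\ge\varsigma k^I(r^F)^2$ and every generator $\theta$ of $\mathbb F_{p^D}^\times$, the systematic scalar codes over $\mathbb F_{p^D}$ with parity encoding vectors $(1,\theta^{i-1},\theta^{2(i-1)},\dots,\theta^{(k-1)(i-1)})$, $1\le i\le r^F$, with $k=k^I$ (initial code) and $k=\varsigma k^I$ (final code), and with the partition into consecutive blocks, form a base code as required in 1. Hence 1 gives an explicit code for all such parameters. 3. (*Remaining cases.*) If $r^F\le r^I$ or $k^I\le r^F$, then access-optimal $(n^I,k^I;n^F,\varsigma k^I)$ convertible codes exist, and each of them has conversion bandwidth $\gamma^*(1)$.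 4. (*Tightness.*) For all $k^I\ge1$, $\varsigma\ge2$, $r^I,r^F\ge0$: every MDS $(n^I,k^I;n^F,\varsigma k^I)$ convertible code, over any finite field and with any $\alpha$, has $\gamma\ge\gamma^*(\alpha)$; and for some $\alpha\ge1$ (with $\alpha=r^F$ if $r^I<r^F<k^I$) and some finite field there is one with $\gamma=\gamma^*(\alpha)$. -/

import Mathlib

/-- An `[n, k, α]` linear vector code over `F`, given with its encoding function: a message has `k`
symbols, a codeword has `n` symbols, and every symbol is a vector of `α` subsymbols. -/
structure VectorCode (F : Type) [Field F] (n k α : ℕ) where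
  encode : (Fin k → Fin α → F) →ₗ[F] (Fin n → Fin α → F)
  injective : Function.Injective encode

namespace VectorCode

variable {F : Type} [Field F] {n k r α : ℕ}

/-- The code itself, a subspace of dimension `k * α`. -/
def code (C : VectorCode F n k α) : Submodule F (Fin n → Fin α → F) :=
  LinearMap.range C.encode

open Classical in
/-- Minimum distance, counted in symbols (not in subsymbols). -/
noncomputable def minDist (C : VectorCode F n k α) : ℕ :=
  sInf {d | ∃ c ∈ C.code, ∃ c' ∈ C.code, c ≠ c' ∧ hammingDist c c' = d}

/-- Maximum distance separable. -/
def IsMDS (C : VectorCode F n k α) : Prop :=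
  C.minDist = n - k + 1

/-- Every message is a prefix of its encoding. -/
def IsSystematic (C : VectorCode F n k α) : Prop :=
  ∀ (m : Fin k → Fin α → F) (l : Fin k) (x : Fin n), (x : ℕ) = l → C.encode m x = m l

/-- The encoding of a scalar code (`α = 1`), with symbols read as elements of `F`; as a function of
`u` it is the linear functional given by the encoding vector of symbol `x`. -/
def scalarEncode (C : VectorCode F n k 1) (x : Fin n) : (Fin k → F) →ₗ[F] F where
  toFun u := C.encode (fun l _ => u l) x 0
  map_add' u v := by
    have h : (fun (l : Fin k) (_ : Fin 1) => (u + v) l)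
        = (fun (l : Fin k) (_ : Fin 1) => u l) + (fun (l : Fin k) (_ : Fin 1) => v l) := rfl
    rw [h, map_add]; rfl
  map_smul' a u := by
    have h : (fun (l : Fin k) (_ : Fin 1) => (a • u) l)
        = a • (fun (l : Fin k) (_ : Fin 1) => u l) := rfl
    rw [h, map_smul]; rfl

/-- `α` independent instances of a scalar code, instance `j` occupying coordinate `j` of
every symbol. -/
def instances (C : VectorCode F n k 1) (α : ℕ) : VectorCode F n k α where
  encode :=
    { toFun := fun m x j => C.scalarEncode x (fun l => m l j)
      map_add' := fun m m' => by
        funext x j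
        exact (C.scalarEncode x).map_add (fun l => m l j) (fun l => m' l j)
      map_smul' := fun a m => by
        funext x j
        exact (C.scalarEncode x).map_smul a (fun l => m l j) }
  injective := by
    intro m m' h
    funext l j
    have h2 : (fun (l : Fin k) (_ : Fin 1) => m l j) = fun l _ => m' l j := by
      apply C.injective
      funext x t
      have ht : t = 0 := Subsingleton.elim _ _
      rw [ht]
      exact congrFun (congrFun h x) j
    exact congrFun (congrFun h2 l) 0

/-- The systematic code with `k` message nodes followed by the `r` parity nodes `P m`. -/
def ofParities (P : (Fin k → Fin α → F) →ₗ[F] (Fin r → Fin α → F)) :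
    VectorCode F (k + r) k α where
  encode :=
    { toFun := fun m => Fin.append m (P m)
      map_add' := fun m m' => by
        funext x
        refine Fin.addCases (fun l => ?_) (fun i => ?_) x <;> simp
      map_smul' := fun a m => by
        funext x
        refine Fin.addCases (fun l => ?_) (fun i => ?_) x <;> simp }
  injective := by
    intro m m' h
    funext l
    have := congrFun h (Fin.castAdd r l)
    simpa using this

/-- The systematic scalar code whose `i`-th parity (`i = 0, …, r - 1`) has encoding vector
`(1, θ ^ i, θ ^ (2 i), …, θ ^ ((k - 1) i))`. -/
def vandermonde (θ : F) (k r : ℕ) : VectorCode F (k + r) k 1 :=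
  ofParities
    { toFun := fun m i t => ∑ l : Fin k, θ ^ ((i : ℕ) * (l : ℕ)) * m l t
      map_add' := fun m m' => by
        funext i t
        simp [mul_add, Finset.sum_add_distrib]
      map_smul' := fun a m => by
        funext i t
        simp only [Pi.smul_apply, smul_eq_mul, RingHom.id_apply, Finset.mul_sum]
        exact Finset.sum_congr rfl fun l _ => by ring }

/-- The piggybacked initial code. The base code `C` has `rF` parities; the last `rF - rI` of them
are punctured, `rF` instances of the punctured code are taken, and to coordinate `j ≥ rI` of parity
`i < rI` one adds the `j`-th (punctured) parity of instance `i`. (Indices start from `0`.) -/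
def piggyback {k rI rF : ℕ} (C : VectorCode F (k + rF) k 1) (h : rI ≤ rF) :
    VectorCode F (k + rI) k rF :=
  ofParities
    { toFun := fun m i j =>
        C.scalarEncode (Fin.natAdd k (Fin.castLE h i)) (fun l => m l j) +
          if rI ≤ (j : ℕ) then C.scalarEncode (Fin.natAdd k j) (fun l => m l (Fin.castLE h i))
          else 0
      map_add' := fun m m' => by
        funext i j
        have e1 := (C.scalarEncode (Fin.natAdd k (Fin.castLE h i))).map_add
          (fun l => m l j) (fun l => m' l j)
        have e2 := (C.scalarEncode (Fin.natAdd k j)).map_add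
          (fun l => m l (Fin.castLE h i)) (fun l => m' l (Fin.castLE h i))
        simp only [Pi.add_def] at e1 e2 ⊢
        split_ifs
        · rw [e1, e2]; ring
        · rw [e1]; ring
      map_smul' := fun a m => by
        funext i j
        have e1 := (C.scalarEncode (Fin.natAdd k (Fin.castLE h i))).map_smul a
          (fun l => m l j)
        have e2 := (C.scalarEncode (Fin.natAdd k j)).map_smul a
          (fun l => m l (Fin.castLE h i))
        simp only [Pi.smul_def, smul_eq_mul, RingHom.id_apply] at e1 e2 ⊢
        split_ifs
        · rw [e1, e2]; ring
        · rw [e1]; ring }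

end VectorCode

/-- An `(nI, kI; nF, ς * kI)` convertible code in the merge regime: `ς` codewords of an initial
`[nI, kI, α]` code are converted into one codeword of a final `[nF, ς * kI, α]` code that encodes
the same message. An initial node is a pair `(s, x)`: node `x` of initial codeword `s`. -/
structure MergeConvertibleCode (F : Type) [Field F] (nI kI nF ς α : ℕ) where
  initialCode : VectorCode F nI kI α
  finalCode : VectorCode F nF (ς * kI) α
  /-- The initial partition: message symbol `partition (s, l)` is the `l`-th message symbol
  of initial codeword `s`. (The final partition has a single block.) -/
  partition : Fin ς × Fin kI ≃ Fin (ς * kI)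
  /-- The initial node that is kept unchanged as a given final node; `none` for a new node. -/
  origin : Fin nF → Option (Fin ς × Fin nI)
  origin_inj : ∀ y y' x, origin y = some x → origin y' = some x → y = y'
  unchanged_eq : ∀ (m : Fin (ς * kI) → Fin α → F) (y : Fin nF) (s : Fin ς) (x : Fin nI),
    origin y = some (s, x) →
      finalCode.encode m y = initialCode.encode (fun l => m (partition (s, l))) x
  /-- The number of subsymbols downloaded from each initial node. -/
  β : Fin ς × Fin nI → ℕ
  β_le : ∀ x, β x ≤ α
  /-- What is downloaded, as a function of the content of the node. -/
  download : ∀ x, (Fin α → F) → (Fin (β x) → F)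
  /-- The coordinator computes the contents of the new nodes from the downloaded data. -/
  convert : (∀ x, Fin (β x) → F) → {y : Fin nF // origin y = none} → (Fin α → F)
  convert_eq : ∀ (m : Fin (ς * kI) → Fin α → F) (y : {y : Fin nF // origin y = none}),
    convert
      (fun x => download x (initialCode.encode (fun l => m (partition (x.1, l))) x.2)) y
      = finalCode.encode m y

namespace MergeConvertibleCode

variable {F : Type} [Field F] {nI kI nF ς α : ℕ}

/-- Both codes are MDS. -/
def IsMDS (X : MergeConvertibleCode F nI kI nF ς α) : Prop :=
  X.initialCode.IsMDS ∧ X.finalCode.IsMDS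

/-- The conversion procedure is linear. -/
def IsLinear (X : MergeConvertibleCode F nI kI nF ς α) : Prop :=
  (∀ x, IsLinearMap F (X.download x)) ∧ IsLinearMap F X.convert

def IsUnchanged (X : MergeConvertibleCode F nI kI nF ς α) (x : Fin ς × Fin nI) : Prop :=
  ∃ y, X.origin y = some x

def IsRetired (X : MergeConvertibleCode F nI kI nF ς α) (x : Fin ς × Fin nI) : Prop :=
  ¬ X.IsUnchanged x

/-- Exactly the subsymbols with coordinates in `J` are downloaded from the initial node `x`,
without any processing at the node (in particular `X.β x` is the size of `J`). -/
def DownloadsSubsymbols (X : MergeConvertibleCode F nI kI nF ς α) (x : Fin ς × Fin nI)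
    (J : Finset (Fin α)) : Prop :=
  ∃ e : Fin (X.β x) ≃ J, ∀ (v : Fin α → F) (t : Fin (X.β x)), X.download x v t = v (e t)

/-- The number of new nodes. -/
def newCount (X : MergeConvertibleCode F nI kI nF ς α) : ℕ :=
  (Finset.univ.filter fun y => (X.origin y).isNone).card

/-- Conversion bandwidth: all data sent to the coordinator plus all data sent to new nodes. -/
def bandwidth (X : MergeConvertibleCode F nI kI nF ς α) : ℕ :=
  ∑ x, X.β x + X.newCount * α

/-- Access cost: the number of symbols read plus the number of symbols written. -/
def accessCost (X : MergeConvertibleCode F nI kI nF ς α) : ℕ :=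
  (Finset.univ.filter fun x => 0 < X.β x).card + X.newCount

/-- A scalar MDS convertible code of minimum access cost among all scalar MDS convertible codes
with the same parameters (over any finite field). -/
def IsAccessOptimal (X : MergeConvertibleCode F nI kI nF ς 1) : Prop :=
  X.IsMDS ∧ ∀ (K : Type) [Field K] [Finite K] (Y : MergeConvertibleCode K nI kI nF ς 1),
    Y.IsMDS → X.accessCost ≤ Y.accessCost

/-- An access-optimal convertible code that can serve as base code for piggybacking: it is
systematic, and its conversion procedure reads parity nodes only. -/
def IsBase {rI rF : ℕ} (X : MergeConvertibleCode F (kI + rI) kI (ς * kI + rF) ς 1) : Prop :=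
  X.IsAccessOptimal ∧ X.initialCode.IsSystematic ∧ X.finalCode.IsSystematic ∧
    ∀ (s : Fin ς) (l : Fin kI), X.β (s, Fin.castAdd rI l) = 0

end MergeConvertibleCode

/-- The lower bound on the conversion bandwidth in the merge regime. -/
def mergeBandwidthBound (kI rI rF ς α : ℕ) : ℚ :=
  if rF ≤ rI ∨ kI ≤ rF then
    (ς : ℚ) * α * min (kI : ℚ) rF + rF * α
  else
    (ς : ℚ) * α * (rI + kI * (1 - (rI : ℚ) / rF)) + rF * α

/-!
*Lower bound.* In an MDS final code with `rF` parities, any `rF` nodes can be erased. Erase `rF`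
of the unchanged nodes of one initial codeword: its message is still determined by its other
unchanged nodes and by what is downloaded from the erased and the retired nodes. Comparing numbers
of possible values (the downloads need not be linear) bounds the downloads from below
(`MergeConvertibleCode.mul_le_mul_card_add_sum`). The best choice is to erase the `rF` unchanged
nodes with the smallest downloads, which have at most average weight; this, the trivial bound `α`
for each retired node, and the fact that at most `kI` nodes of each initial codeword are unchanged
(`card_unchanged_le`) give the contribution of each initial codeword (`bound_le_sum_add`), and their
sum is the bound `mergeBandwidthBound_le_bandwidth`.

*Base codes.* The minors of the parity matrix `θ ^ (i * l)` are values at `θ` of polynomials in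
which, by the rearrangement inequality, a single permutation contributes the top monomial. These
polynomials are nonzero, and their degree is less than the degree `D` of `θ` over the prime field,
so that the Vandermonde codes are MDS (`VectorCode.isMDS_vandermonde_of_generator`). On a block of
consecutive message symbols the parities of the final code are multiples of those of the initial
code (`exists_conversion_vandermonde`). For scalar codes, bandwidth equals access cost, so a code
that meets the lower bound is access-optimal.

*Piggybacking.* In any base code the final parities are linear functions of the initial parities
(`exists_linear_of_reads_parities`). The subsymbols `j ≥ rI` of the systematic nodes determine the
instances `j ≥ rI` completely; for an instance `j < rI`, the first `rI` parities are read directly,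
and the punctured ones are the piggybacks of parity `j`, from which a known term is subtracted
(`recoverParities_piggyback`).
-/

/-! ### MDS codes -/

namespace VectorCode

variable {F : Type} [Field F] {n k r α : ℕ}

/-- In an MDS code any `k` symbols of a codeword determine the message. -/
theorem IsMDS.eq_of_eqOn {C : VectorCode F (k + r) k α} (hC : C.IsMDS)
    {m m' : Fin k → Fin α → F} {S : Finset (Fin (k + r))} (hS : k ≤ S.card)
    (h : ∀ y ∈ S, C.encode m y = C.encode m' y) : m = m' := by
  classical
  by_contra hne
  have hle : C.minDist ≤ hammingDist (C.encode m) (C.encode m') := by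
    refine Nat.sInf_le ⟨_, ⟨m, rfl⟩, _, ⟨m', rfl⟩, fun e => hne (C.injective e), ?_⟩
    convert rfl
  have hsub : (Finset.univ.filter fun y => C.encode m y ≠ C.encode m' y) ⊆ Sᶜ := by
    intro y hy
    simp only [Finset.mem_filter, Finset.mem_univ, true_and, Finset.mem_compl] at hy ⊢
    exact fun hyS => hy (h y hyS)
  have h2 := Finset.card_le_card hsub
  rw [Finset.card_compl, Fintype.card_fin] at h2
  have h3 : C.minDist = k + r - k + 1 := hC
  have h4 : hammingDist (C.encode m) (C.encode m') =
    (Finset.univ.filter fun y => C.encode m y ≠ C.encode m' y).card := rfl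
  omega

theorem IsMDS.eq_zero {C : VectorCode F (k + r) k α} (hC : C.IsMDS)
    {m : Fin k → Fin α → F} {S : Finset (Fin (k + r))} (hS : k ≤ S.card)
    (h : ∀ y ∈ S, C.encode m y = 0) : m = 0 :=
  hC.eq_of_eqOn hS fun y hy => by rw [h y hy, map_zero, Pi.zero_apply]

/-- For `α = 0` the code is trivial and its minimum distance is the junk value `sInf ∅ = 0`. -/
theorem IsMDS.pos {C : VectorCode F n k α} (hC : C.IsMDS) : 0 < α := by
  classical
  rcases Nat.eq_zero_or_pos α with rfl | h
  · exfalso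
    have h3 : C.minDist = n - k + 1 := hC
    have : C.minDist = 0 := by
      unfold minDist
      convert Nat.sInf_empty
      ext d
      simp only [Set.mem_ofPred_eq, Set.mem_empty_iff_false, iff_false]
      rintro ⟨c, -, c', -, hne, -⟩
      exact hne (Subsingleton.elim _ _)
    omega
  · exact h

/-- A code in which any `k` symbols determine the message is MDS. The Singleton bound, which is the
other half of the equality, holds because restriction to `k` nodes is then bijective. -/
theorem isMDS_of_forall (C : VectorCode F (k + r) k α) (hk : 0 < k) (hα : 0 < α)
    (H : ∀ (m : Fin k → Fin α → F) (S : Finset (Fin (k + r))), S.card = k →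
      (∀ y ∈ S, C.encode m y = 0) → m = 0) : C.IsMDS := by
  classical
  have lower : ∀ m m', C.encode m ≠ C.encode m' →
      r + 1 ≤ hammingDist (C.encode m) (C.encode m') := by
    intro m m' hne
    by_contra hlt
    have h4 : hammingDist (C.encode m) (C.encode m') =
      (Finset.univ.filter fun y => ¬ (C.encode m y = C.encode m' y)).card := rfl
    have h5 := Finset.card_filter_add_card_filter_not (s := Finset.univ)
      (fun y => C.encode m y = C.encode m' y)
    rw [Finset.card_univ, Fintype.card_fin] at h5
    obtain ⟨S, hS, hSk⟩ := Finset.exists_subset_card_eq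
      (s := Finset.univ.filter fun y => C.encode m y = C.encode m' y) (n := k) (by omega)
    have := H (m - m') S hSk fun y hy => by
      have := (Finset.mem_filter.1 (hS hy)).2
      rw [map_sub, Pi.sub_apply, this, sub_self]
    exact hne (by rw [sub_eq_zero.1 this])
  -- the Singleton bound: some codeword vanishes at all but one of the first `k` nodes
  let R : (Fin k → Fin α → F) →ₗ[F] (Fin k → Fin α → F) :=
    { toFun := fun m l => C.encode m (Fin.castAdd r l)
      map_add' := fun m m' => by funext l; simp
      map_smul' := fun a m => by funext l; simp }
  have hinj : Function.Injective R := by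
    rw [← LinearMap.ker_eq_bot, LinearMap.ker_eq_bot']
    intro m hm
    refine H m (Finset.univ.map (Fin.castAddEmb r)) (by simp) fun y hy => ?_
    obtain ⟨l, -, rfl⟩ := Finset.mem_map.1 hy
    exact congrFun hm l
  obtain ⟨m, hm⟩ := LinearMap.injective_iff_surjective.1 hinj (Pi.single ⟨0, hk⟩ fun _ => 1)
  have hm' : ∀ l, C.encode m (Fin.castAdd r l) =
      (Pi.single ⟨0, hk⟩ (fun _ => 1) : Fin k → Fin α → F) l := fun l => congrFun hm l
  have hm0 : C.encode m ≠ C.encode 0 := by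
    intro e
    have h1 := hm' ⟨0, hk⟩
    rw [e, map_zero, Pi.single_eq_same] at h1
    exact zero_ne_one (congrFun h1 ⟨0, hα⟩)
  have upper : hammingDist (C.encode m) (C.encode 0) ≤ r + 1 := by
    have h4 : hammingDist (C.encode m) (C.encode 0) =
      (Finset.univ.filter fun y => C.encode m y ≠ C.encode 0 y).card := rfl
    have hsub : (Finset.univ.filter fun y => C.encode m y ≠ C.encode 0 y) ⊆
        insert (Fin.castAdd r ⟨0, hk⟩) (Finset.univ.map (Fin.natAddEmb k)) := by
      intro y
      refine Fin.addCases (fun l hy => ?_) (fun i _ => ?_) y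
      · rw [Finset.mem_filter, hm', map_zero] at hy
        rw [Finset.mem_insert]
        left
        by_contra hl
        exact hy.2 (by rw [Pi.single_eq_of_ne (fun e => hl (by rw [e]))]; rfl)
      · simp
    have h5 := (Finset.card_le_card hsub).trans (Finset.card_insert_le _ _)
    rw [Finset.card_map, Finset.card_univ, Fintype.card_fin] at h5
    exact h4.le.trans h5
  have key : C.minDist = r + 1 := by
    apply le_antisymm
    · have : C.minDist ≤ hammingDist (C.encode m) (C.encode 0) := by
        refine Nat.sInf_le ⟨_, ⟨m, rfl⟩, _, ⟨0, rfl⟩, hm0, ?_⟩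
        convert rfl
      exact this.trans upper
    · refine le_csInf ⟨_, _, ⟨m, rfl⟩, _, ⟨0, rfl⟩, hm0, rfl⟩ ?_
      rintro d ⟨_, ⟨m, rfl⟩, _, ⟨m', rfl⟩, hne, rfl⟩
      convert lower m m' hne
  unfold IsMDS
  omega

theorem encode_eq_scalarEncode (C : VectorCode F n k 1) (m : Fin k → Fin 1 → F) (x : Fin n)
    (t : Fin 1) : C.encode m x t = C.scalarEncode x (fun l => m l 0) := by
  have h : m = fun l _ => m l 0 := by
    funext l t
    rw [Subsingleton.elim t 0]
  rw [Subsingleton.elim t 0, h]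
  rfl

theorem IsMDS.eq_zero_of_scalarEncode {C : VectorCode F (k + r) k 1} (hC : C.IsMDS)
    {u : Fin k → F} {S : Finset (Fin (k + r))} (hS : k ≤ S.card)
    (h : ∀ y ∈ S, C.scalarEncode y u = 0) : u = 0 := by
  have := hC.eq_zero (m := fun l _ => u l) hS fun y hy => by
    funext t
    rw [encode_eq_scalarEncode]
    exact h y hy
  funext l
  exact congrFun (congrFun this l) 0

theorem IsMDS.instances {C : VectorCode F (k + r) k 1} (hC : C.IsMDS) (hk : 0 < k)
    (hα : 0 < α) : (C.instances α).IsMDS := by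
  refine isMDS_of_forall _ hk hα fun m S hS h => ?_
  funext l j
  exact congrFun (hC.eq_zero_of_scalarEncode (u := fun l => m l j) hS.ge
    fun y hy => congrFun (h y hy) j) l

theorem IsSystematic.encode_castAdd {C : VectorCode F (k + r) k α} (h : C.IsSystematic)
    (m : Fin k → Fin α → F) (l : Fin k) : C.encode m (Fin.castAdd r l) = m l :=
  h m l _ rfl

theorem IsSystematic.scalarEncode_castAdd {C : VectorCode F (k + r) k 1} (h : C.IsSystematic)
    (u : Fin k → F) (l : Fin k) : C.scalarEncode (Fin.castAdd r l) u = u l :=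
  congrFun (h.encode_castAdd (fun l _ => u l) l) 0

theorem isSystematic_of_castAdd {C : VectorCode F (k + r) k α}
    (h : ∀ m l, C.encode m (Fin.castAdd r l) = m l) : C.IsSystematic := by
  intro m l x hx
  have : x = Fin.castAdd r l := Fin.ext hx
  rw [this, h]

theorem isSystematic_ofParities (P : (Fin k → Fin α → F) →ₗ[F] (Fin r → Fin α → F)) :
    (ofParities P).IsSystematic :=
  isSystematic_of_castAdd fun m l => Fin.append_left m (P m) l

theorem ofParities_encode_natAdd (P : (Fin k → Fin α → F) →ₗ[F] (Fin r → Fin α → F))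
    (m : Fin k → Fin α → F) (i : Fin r) : (ofParities P).encode m (Fin.natAdd k i) = P m i :=
  Fin.append_right m (P m) i

theorem IsSystematic.instances {C : VectorCode F (k + r) k 1} (h : C.IsSystematic) (α : ℕ) :
    (C.instances α).IsSystematic :=
  isSystematic_of_castAdd fun m l => by
    funext j
    exact h.scalarEncode_castAdd (fun l => m l j) l

theorem piggyback_encode_natAdd {rI rF : ℕ} (C : VectorCode F (k + rF) k 1) (h : rI ≤ rF)
    (m : Fin k → Fin rF → F) (i : Fin rI) (j : Fin rF) :
    (C.piggyback h).encode m (Fin.natAdd k i) j =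
      C.scalarEncode (Fin.natAdd k (Fin.castLE h i)) (fun l => m l j) +
        if rI ≤ (j : ℕ) then C.scalarEncode (Fin.natAdd k j) (fun l => m l (Fin.castLE h i))
        else 0 :=
  congrFun (ofParities_encode_natAdd _ m i) j

theorem isSystematic_piggyback {rI rF : ℕ} (C : VectorCode F (k + rF) k 1) (h : rI ≤ rF) :
    (C.piggyback h).IsSystematic :=
  isSystematic_ofParities _

/-- Decoding is possible from any `k` nodes: the coordinates `j < rI` carry no piggyback and are
decoded as in the base code; once they are known, the piggybacks can be removed from the
coordinates `j ≥ rI`. -/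
theorem IsMDS.piggyback {rI rF : ℕ} {C : VectorCode F (k + rF) k 1} (hC : C.IsMDS)
    (hs : C.IsSystematic) (h : rI ≤ rF) (hk : 0 < k) (hF : 0 < rF) :
    (C.piggyback h).IsMDS := by
  refine isMDS_of_forall _ hk hF fun m S hS hm => ?_
  -- a coordinate can be decoded once the messages in its piggybacks vanish
  have step : ∀ j : Fin rF, (∀ i : Fin rI, rI ≤ (j : ℕ) → ∀ l, m l (Fin.castLE h i) = 0) →
      ∀ l, m l j = 0 := by
    intro j hj l
    refine congrFun (hC.eq_zero_of_scalarEncode (u := fun l => m l j)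
      (S := S.map (Fin.castLEEmb (Nat.add_le_add_left h k))) (by simp [hS]) fun y hy => ?_) l
    obtain ⟨x, hx, rfl⟩ := Finset.mem_map.1 hy
    have hx0 := congrFun (hm x hx) j
    clear hy hx
    revert hx0
    refine Fin.addCases (fun l' hx0 => ?_) (fun i hx0 => ?_) x
    · rw [(isSystematic_piggyback C h).encode_castAdd] at hx0
      exact (hs.scalarEncode_castAdd (fun l => m l j) l').trans hx0
    · rw [piggyback_encode_natAdd] at hx0
      have e : (if rI ≤ (j : ℕ) then
          C.scalarEncode (Fin.natAdd k j) (fun l => m l (Fin.castLE h i)) else 0) = 0 := by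
        split_ifs with hrj
        · rw [funext (hj i hrj)]
          exact map_zero _
        · rfl
      rw [e, add_zero] at hx0
      exact hx0
  have low : ∀ j : Fin rF, (j : ℕ) < rI → ∀ l, m l j = 0 := fun j hj =>
    step j fun _ h' => absurd h' (not_le.2 hj)
  funext l j
  exact step j (fun i _ => low _ i.2) l

end VectorCode

/-! ### The lower bound -/

/-- Some `r` elements of `U` have at most the average weight, namely the `r` lightest ones. -/
theorem Finset.exists_subset_card_eq_card_mul_sum_le {ι : Type*} (f : ι → ℕ) (U : Finset ι) :
    ∀ r ≤ U.card, ∃ W ⊆ U, W.card = r ∧ U.card * ∑ x ∈ W, f x ≤ r * ∑ x ∈ U, f x := by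
  classical
  induction U using Finset.strongInduction with
  | H U ih =>
    intro r hr
    rcases Nat.eq_zero_or_pos r with rfl | hr0
    · exact ⟨∅, Finset.empty_subset _, rfl, by simp⟩
    rcases hr.eq_or_lt with rfl | hlt
    · exact ⟨U, subset_rfl, rfl, le_rfl⟩
    obtain ⟨x, hx, hmax⟩ := U.exists_max_image f (Finset.card_pos.1 (by omega))
    obtain ⟨W, hW, hWr, hle⟩ := ih (U.erase x) (Finset.erase_ssubset hx) r
      (by rw [Finset.card_erase_of_mem hx]; omega)
    refine ⟨W, hW.trans (Finset.erase_subset _ _), hWr, ?_⟩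
    obtain ⟨c, hc⟩ : ∃ c, U.card = c + 1 := ⟨U.card - 1, by omega⟩
    have hc' : (U.erase x).card = c := by rw [Finset.card_erase_of_mem hx]; omega
    have hsum := Finset.add_sum_erase U f hx
    -- removing a heaviest element does not increase the average
    have havg : ∑ y ∈ U.erase x, f y ≤ c * f x := by
      have := Finset.sum_le_card_nsmul (U.erase x) f (f x)
        fun y hy => hmax y (Finset.mem_of_mem_erase hy)
      rwa [hc', smul_eq_mul] at this
    rw [hc'] at hle
    rw [hc, ← hsum]
    have hcpos : 0 < c := by omega
    refine (Nat.mul_le_mul_left_iff hcpos).1 ?_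
    set A := ∑ y ∈ W, f y
    set B := ∑ y ∈ U.erase x, f y
    have h1 := Nat.mul_le_mul_left (c + 1) hle
    have h2 := Nat.mul_le_mul_left r havg
    nlinarith

namespace MergeConvertibleCode

variable {F : Type} [Field F] {nI kI rF nF ς α : ℕ}

open Classical in
/-- The unchanged nodes of initial codeword `s`. -/
noncomputable def unchanged (X : MergeConvertibleCode F nI kI nF ς α) (s : Fin ς) :
    Finset (Fin nI) :=
  Finset.univ.filter fun x => X.IsUnchanged (s, x)

theorem mem_unchanged {X : MergeConvertibleCode F nI kI nF ς α} {s : Fin ς} {x : Fin nI} :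
    x ∈ X.unchanged s ↔ X.IsUnchanged (s, x) := by
  simp [unchanged]

/-- The final nodes that are unchanged nodes of initial codeword `s`. -/
def unchangedFinal (X : MergeConvertibleCode F nI kI nF ς α) (s : Fin ς) : Finset (Fin nF) :=
  Finset.univ.filter fun y => (X.origin y).map Prod.fst = some s

theorem mem_unchangedFinal {X : MergeConvertibleCode F nI kI nF ς α} {s : Fin ς} {y : Fin nF} :
    y ∈ X.unchangedFinal s ↔ ∃ x, X.origin y = some (s, x) := by
  simp [unchangedFinal]

theorem card_unchangedFinal (X : MergeConvertibleCode F nI kI nF ς α) (s : Fin ς) :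
    (X.unchangedFinal s).card = (X.unchanged s).card := by
  classical
  have h : ∀ y ∈ X.unchangedFinal s, ∃ x, X.origin y = some (s, x) :=
    fun y => mem_unchangedFinal.1
  choose g hg using h
  refine Finset.card_bij g (fun y hy => mem_unchanged.2 ⟨y, hg y hy⟩) ?_ ?_
  · intro y hy y' hy' e
    exact X.origin_inj y y' _ (hg y hy) (by rw [hg y' hy', e])
  · intro x hx
    obtain ⟨y, hy⟩ := mem_unchanged.1 hx
    have hmem : y ∈ X.unchangedFinal s := mem_unchangedFinal.2 ⟨x, hy⟩
    refine ⟨y, hmem, ?_⟩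
    have := (hg y hmem).symm.trans hy
    simpa using this

theorem newCount_add_sum_card_unchanged (X : MergeConvertibleCode F nI kI nF ς α) :
    X.newCount + ∑ s, (X.unchanged s).card = nF := by
  classical
  have h := Finset.card_eq_sum_card_fiberwise (s := (Finset.univ : Finset (Fin nF)))
    (t := (Finset.univ : Finset (Option (Fin ς)))) (f := fun y => (X.origin y).map Prod.fst)
    (fun _ _ => by simp)
  rw [Finset.card_univ, Fintype.card_fin, Fintype.sum_option] at h
  refine Eq.trans ?_ h.symm
  congr 1
  · unfold newCount
    congr 1
    ext y
    simp
  · exact Finset.sum_congr rfl fun s _ => (X.card_unchangedFinal s).symm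

/-- The message whose part in initial codeword `s` is `u`, and whose other symbols are `0`. -/
def extendMessage (X : MergeConvertibleCode F nI kI nF ς α) (s : Fin ς)
    (u : Fin kI → Fin α → F) : Fin (ς * kI) → Fin α → F :=
  fun l => if (X.partition.symm l).1 = s then u (X.partition.symm l).2 else 0

theorem extendMessage_self (X : MergeConvertibleCode F nI kI nF ς α) (s : Fin ς)
    (u : Fin kI → Fin α → F) (l : Fin kI) : X.extendMessage s u (X.partition (s, l)) = u l := by
  simp [extendMessage]

theorem extendMessage_of_ne (X : MergeConvertibleCode F nI kI nF ς α) {s t : Fin ς} (h : t ≠ s)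
    (u : Fin kI → Fin α → F) (l : Fin kI) : X.extendMessage s u (X.partition (t, l)) = 0 := by
  simp [extendMessage, h]

/-- Final codewords agree at the new nodes if all downloads agree. -/
theorem encode_eq_of_download_eq (X : MergeConvertibleCode F nI kI nF ς α)
    {m m' : Fin (ς * kI) → Fin α → F} {y : Fin nF} (hy : X.origin y = none)
    (h : ∀ s x, X.download (s, x) (X.initialCode.encode (fun l => m (X.partition (s, l))) x) =
      X.download (s, x) (X.initialCode.encode (fun l => m' (X.partition (s, l))) x)) :
    X.finalCode.encode m y = X.finalCode.encode m' y := by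
  rw [← X.convert_eq m ⟨y, hy⟩, ← X.convert_eq m' ⟨y, hy⟩]
  congr 1
  funext x
  exact h x.1 x.2

variable [Finite F]

/-- The cut-set bound. Suppose that at most `rF` unchanged nodes of codeword `s` are outside `T`.
The final code corrects their erasure, so the message of codeword `s` is determined by the nodes in
`T` and what is downloaded from the other initial nodes of codeword `s`. -/
theorem mul_le_mul_card_add_sum (X : MergeConvertibleCode F nI kI (ς * kI + rF) ς α)
    (hX : X.finalCode.IsMDS) (s : Fin ς) {T : Finset (Fin nI)} (hT : T ⊆ X.unchanged s)
    (hcard : (X.unchanged s).card ≤ T.card + rF) :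
    α * kI ≤ α * T.card + ∑ x ∈ Tᶜ, X.β (s, x) := by
  classical
  have := Fintype.ofFinite F
  let φ : (Fin kI → Fin α → F) →
      (T → Fin α → F) × (∀ x : (Tᶜ : Finset (Fin nI)), Fin (X.β (s, x)) → F) := fun u =>
    (fun x => X.initialCode.encode u x, fun x => X.download (s, x) (X.initialCode.encode u x))
  have hinj : Function.Injective φ := by
    intro u u' h
    have h1 : ∀ x ∈ T, X.initialCode.encode u x = X.initialCode.encode u' x := fun x hx =>
      congrFun (congrArg Prod.fst h) ⟨x, hx⟩
    have h2 : ∀ x ∉ T, X.download (s, x) (X.initialCode.encode u x) =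
        X.download (s, x) (X.initialCode.encode u' x) := fun x hx =>
      congrFun (congrArg Prod.snd h) ⟨x, Finset.mem_compl.2 hx⟩
    have hpart : ∀ t, t ≠ s → ∀ u : Fin kI → Fin α → F,
        (fun l => X.extendMessage s u (X.partition (t, l))) = 0 := fun t ht u =>
      funext fun l => X.extendMessage_of_ne ht u l
    have hpart' : ∀ u : Fin kI → Fin α → F,
        (fun l => X.extendMessage s u (X.partition (s, l))) = u := fun u =>
      funext fun l => X.extendMessage_self s u l
    have hdown : ∀ t x, X.download (t, x)
          (X.initialCode.encode (fun l => X.extendMessage s u (X.partition (t, l))) x) =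
        X.download (t, x)
          (X.initialCode.encode (fun l => X.extendMessage s u' (X.partition (t, l))) x) := by
      intro t x
      by_cases ht : t = s
      · subst ht
        rw [hpart', hpart']
        by_cases hx : x ∈ T
        · rw [h1 x hx]
        · exact h2 x hx
      · rw [hpart t ht, hpart t ht]
    -- the final nodes that may differ
    let bad := (X.unchangedFinal s).filter fun y => ∀ x ∈ T, X.origin y ≠ some (s, x)
    have hbad : bad.card ≤ rF := by
      have e := Finset.card_filter_add_card_filter_not (s := X.unchangedFinal s)
        (fun y => ∀ x ∈ T, X.origin y ≠ some (s, x))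
      have : T.card ≤ ((X.unchangedFinal s).filter
          fun y => ¬ ∀ x ∈ T, X.origin y ≠ some (s, x)).card := by
        choose g hg using fun x : T => mem_unchanged.1 (hT x.2)
        rw [← Fintype.card_coe T, ← Finset.card_univ]
        refine Finset.card_le_card_of_injOn g (fun x _ => ?_) fun x _ x' _ e => ?_
        · rw [Finset.mem_coe, Finset.mem_filter, mem_unchangedFinal]
          exact ⟨⟨x, hg x⟩, fun h => h x x.2 (hg x)⟩
        · have h3 := hg x
          rw [e] at h3
          have h4 := h3.symm.trans (hg x')
          simp only [Option.some.injEq, Prod.mk.injEq, true_and] at h4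
          exact Subtype.ext h4
      rw [X.card_unchangedFinal] at e
      change bad.card + _ = _ at e
      omega
    have hM : X.extendMessage s u = X.extendMessage s u' := by
      refine hX.eq_of_eqOn (S := badᶜ) ?_ fun y hy => ?_
      · rw [Finset.card_compl, Fintype.card_fin]
        omega
      rcases hor : X.origin y with _ | ⟨t, x⟩
      · exact X.encode_eq_of_download_eq hor hdown
      · rw [X.unchanged_eq _ y t x hor, X.unchanged_eq _ y t x hor]
        by_cases ht : t = s
        · subst ht
          rw [hpart', hpart']
          refine h1 x ?_
          by_contra hx
          refine Finset.mem_compl.1 hy (Finset.mem_filter.2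
            ⟨mem_unchangedFinal.2 ⟨x, hor⟩, fun x' hx' e => hx ?_⟩)
          have : x = x' := by simpa using hor.symm.trans e
          rwa [this]
        · rw [hpart t ht, hpart t ht]
    rw [← hpart' u, ← hpart' u', hM]
  have h := Fintype.card_le_of_injective φ hinj
  simp only [Fintype.card_prod, Fintype.card_pi, Finset.prod_const, Finset.card_univ,
    Fintype.card_fin, Fintype.card_coe, Finset.prod_pow_eq_pow_sum] at h
  rw [← pow_mul, ← pow_mul, ← pow_add, Nat.pow_le_pow_iff_right Fintype.one_lt_card] at h
  rwa [Finset.sum_coe_sort (Tᶜ) (fun x => X.β (s, x))] at h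

/-- At most `kI` nodes of an initial codeword are unchanged: more of them are dependent, while any
`ς * kI` nodes of the final codeword are independent. -/
theorem card_unchanged_le (X : MergeConvertibleCode F nI kI (ς * kI + rF) ς α)
    (hX : X.finalCode.IsMDS) (hk : 1 ≤ kI) (hς : 2 ≤ ς) (s : Fin ς) :
    (X.unchanged s).card ≤ kI := by
  classical
  have := Fintype.ofFinite F
  by_contra hlt
  rw [← X.card_unchangedFinal] at hlt
  have hkk : 2 * kI ≤ ς * kI := Nat.mul_le_mul_right _ hς
  have hcompl := Finset.card_compl (X.unchangedFinal s)
  rw [Fintype.card_fin] at hcompl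
  -- nodes that complete the unchanged ones to a set that determines the message
  obtain ⟨Y, hY, hYc⟩ := Finset.exists_subset_card_eq (s := (X.unchangedFinal s)ᶜ)
    (n := ς * kI - (X.unchangedFinal s).card) (by omega)
  let φ : (Fin (ς * kI) → Fin α → F) → (Fin kI → Fin α → F) × (Y → Fin α → F) := fun m =>
    (fun l => m (X.partition (s, l)), fun y => X.finalCode.encode m y)
  have hinj : Function.Injective φ := by
    intro m m' h
    have h1 : (fun l => m (X.partition (s, l))) = fun l => m' (X.partition (s, l)) :=
      congrArg Prod.fst h
    have h2 : ∀ y ∈ Y, X.finalCode.encode m y = X.finalCode.encode m' y := fun y hy =>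
      congrFun (congrArg Prod.snd h) ⟨y, hy⟩
    have hdisj : Disjoint (X.unchangedFinal s) Y :=
      Finset.disjoint_left.2 fun y hy hy' => Finset.mem_compl.1 (hY hy') hy
    refine hX.eq_of_eqOn (S := X.unchangedFinal s ∪ Y) ?_ fun y hy => ?_
    · rw [Finset.card_union_of_disjoint hdisj]
      omega
    · rcases Finset.mem_union.1 hy with hy | hy
      · obtain ⟨x, hx⟩ := mem_unchangedFinal.1 hy
        rw [X.unchanged_eq _ y s x hx, X.unchanged_eq _ y s x hx, h1]
      · exact h2 y hy
  have h := Fintype.card_le_of_injective φ hinj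
  simp only [Fintype.card_prod, Fintype.card_pi, Finset.prod_const, Finset.card_univ,
    Fintype.card_fin, Fintype.card_coe] at h
  rw [← pow_mul, ← pow_mul, ← pow_mul, ← pow_add, Nat.pow_le_pow_iff_right Fintype.one_lt_card,
    ← Nat.mul_add] at h
  have := Nat.le_of_mul_le_mul_left h hX.pos
  omega

/-- The contribution of one initial codeword to the bound. A missing unchanged node costs one new
node, that is `α` subsymbols. -/
theorem bound_le_sum_add {rI : ℕ} (X : MergeConvertibleCode F (kI + rI) kI (ς * kI + rF) ς α)
    (hX : X.finalCode.IsMDS) (hk : 1 ≤ kI) (hς : 2 ≤ ς) (s : Fin ς) :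
    (if rF ≤ rI ∨ kI ≤ rF then (α : ℚ) * min (kI : ℚ) rF
      else (α : ℚ) * (rI + kI * (1 - (rI : ℚ) / rF))) ≤
    ∑ x, (X.β (s, x) : ℚ) + α * (kI - (X.unchanged s).card) := by
  classical
  have hu := X.card_unchanged_le hX hk hς s
  set U := X.unchanged s with hU
  have huq : (U.card : ℚ) ≤ kI := by exact_mod_cast hu
  have hα : (0 : ℚ) ≤ α := Nat.cast_nonneg α
  rcases le_total U.card rF with hur | hur
  -- with at most `rF` unchanged nodes, all of them can be erased
  · have h := X.mul_le_mul_card_add_sum hX s (T := ∅) (Finset.empty_subset _) (by simpa using hur)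
    rw [Finset.card_empty, mul_zero, zero_add, Finset.compl_empty] at h
    have hq : (α : ℚ) * kI ≤ ∑ x, (X.β (s, x) : ℚ) := by exact_mod_cast h
    have h0 : (0 : ℚ) ≤ α * (kI - U.card) := mul_nonneg hα (by linarith)
    refine le_trans ?_ (hq.trans (le_add_of_nonneg_right h0))
    split_ifs with hc
    · exact mul_le_mul_of_nonneg_left (min_le_left _ _) hα
    · push Not at hc
      refine mul_le_mul_of_nonneg_left ?_ hα
      have hrF : (0 : ℚ) < rF := by exact_mod_cast (Nat.zero_le _).trans_lt hc.1
      have : (rI : ℚ) ≤ kI * (rI / rF) := by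
        rw [← mul_div_assoc, le_div_iff₀ hrF, mul_comm (kI : ℚ)]
        exact mul_le_mul_of_nonneg_left (by exact_mod_cast hc.2.le) (Nat.cast_nonneg _)
      linarith
  · obtain ⟨W, hWU, hWr, hWle⟩ :=
      U.exists_subset_card_eq_card_mul_sum_le (fun x => X.β (s, x)) rF hur
    have hcard := Finset.card_sdiff_add_card_eq_card hWU
    have h := X.mul_le_mul_card_add_sum hX s (T := U \ W) Finset.sdiff_subset
      (by rw [← hU]; omega)
    have hdisj : Disjoint W Uᶜ :=
      Finset.disjoint_left.2 fun x hx hx' => Finset.mem_compl.1 hx' (hWU hx)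
    have hcompl : (U \ W)ᶜ = W ∪ Uᶜ := by
      ext x
      simp only [Finset.mem_compl, Finset.mem_sdiff, Finset.mem_union]
      tauto
    rw [hcompl, Finset.sum_union hdisj] at h
    have hR : ∑ x ∈ Uᶜ, X.β (s, x) ≤ Uᶜ.card * α :=
      Finset.sum_le_card_nsmul _ _ _ fun x _ => X.β_le _
    have hUc : Uᶜ.card + U.card = kI + rI := by
      rw [Finset.card_compl_add_card, Fintype.card_fin]
    have hWsum := Finset.sum_le_sum_of_subset (f := fun x => X.β (s, x)) hWU
    rw [← Finset.sum_add_sum_compl U]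
    rw [hWr] at hcard
    have hq : (α : ℚ) * kI ≤ α * (U.card - rF) +
        (∑ x ∈ W, (X.β (s, x) : ℚ) + ∑ x ∈ Uᶜ, (X.β (s, x) : ℚ)) := by
      have e : ((U \ W).card : ℚ) = U.card - rF := by
        rw [← hcard]; push_cast; ring
      rw [← e]
      exact_mod_cast h
    have hWleq : (U.card : ℚ) * ∑ x ∈ W, (X.β (s, x) : ℚ) ≤ rF * ∑ x ∈ U, (X.β (s, x) : ℚ) := by
      exact_mod_cast hWle
    have hRq : ∑ x ∈ Uᶜ, (X.β (s, x) : ℚ) ≤ (kI + rI - U.card) * α := by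
      have e : (Uᶜ.card : ℚ) = kI + rI - U.card := by
        rw [eq_sub_iff_add_eq]; exact_mod_cast hUc
      rw [← e]
      exact_mod_cast hR
    have hWsumq : ∑ x ∈ W, (X.β (s, x) : ℚ) ≤ ∑ x ∈ U, (X.β (s, x) : ℚ) := by
      exact_mod_cast hWsum
    have hurq : (rF : ℚ) ≤ U.card := by exact_mod_cast hur
    generalize ∑ x ∈ W, (X.β (s, x) : ℚ) = w at *
    generalize ∑ x ∈ U, (X.β (s, x) : ℚ) = b at *
    generalize ∑ x ∈ Uᶜ, (X.β (s, x) : ℚ) = R at *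
    generalize (U.card : ℚ) = u at *
    split_ifs with hc
    · have : (α : ℚ) * min (kI : ℚ) rF ≤ α * rF := mul_le_mul_of_nonneg_left (min_le_right _ _) hα
      have h0 : (0 : ℚ) ≤ α * (kI - u) := mul_nonneg hα (by linarith)
      nlinarith
    · push Not at hc
      have hrF : (0 : ℚ) < rF := by exact_mod_cast (Nat.zero_le _).trans_lt hc.1
      have hrI : (0 : ℚ) ≤ rI := Nat.cast_nonneg _
      -- `b ≥ (u / rF) * w`, where `w` is bounded by the cut and `R` by the number of retired nodes
      have e1 : u * (α * (kI - u + rF) - R) ≤ rF * b :=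
        le_trans (mul_le_mul_of_nonneg_left (by linarith) (by linarith)) hWleq
      have e2 : (u - rF) * R ≤ (u - rF) * ((kI + rI - u) * α) :=
        mul_le_mul_of_nonneg_left hRq (by linarith)
      have e3 : 0 ≤ (α : ℚ) * ((kI - u) * rI) :=
        mul_nonneg hα (mul_nonneg (by linarith) hrI)
      have e4 : 0 ≤ (α : ℚ) * ((kI - u) * rF) :=
        mul_nonneg hα (mul_nonneg (by linarith) hrF.le)
      refine le_of_mul_le_mul_left ?_ hrF
      have e5 : (rF : ℚ) * (α * (rI + kI * (1 - rI / rF))) = α * (rI * rF + kI * (rF - rI)) := by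
        field_simp
      rw [e5]
      nlinarith

/-- The lower bound on the conversion bandwidth. -/
theorem mergeBandwidthBound_le_bandwidth {rI : ℕ}
    (X : MergeConvertibleCode F (kI + rI) kI (ς * kI + rF) ς α) (hX : X.finalCode.IsMDS)
    (hk : 1 ≤ kI) (hς : 2 ≤ ς) : mergeBandwidthBound kI rI rF ς α ≤ (X.bandwidth : ℚ) := by
  have hnew : (X.newCount : ℚ) + ∑ s, ((X.unchanged s).card : ℚ) = ς * kI + rF := by
    exact_mod_cast X.newCount_add_sum_card_unchanged
  have hsum := Finset.sum_le_sum fun (s : Fin ς) (_ : s ∈ Finset.univ) =>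
    X.bound_le_sum_add hX hk hς s
  rw [Finset.sum_const, Finset.card_univ, Fintype.card_fin, nsmul_eq_mul, Finset.sum_add_distrib,
    ← Finset.mul_sum, Finset.sum_sub_distrib, Finset.sum_const, Finset.card_univ,
    Fintype.card_fin, nsmul_eq_mul] at hsum
  have hband : (X.bandwidth : ℚ) = ∑ s, ∑ x, (X.β (s, x) : ℚ) + X.newCount * α := by
    rw [← Fintype.sum_prod_type']
    unfold bandwidth
    push_cast
    rfl
  have hn : (X.newCount : ℚ) = ς * kI + rF - ∑ s, ((X.unchanged s).card : ℚ) := by linarith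
  rw [hband, hn]
  unfold mergeBandwidthBound
  split_ifs at hsum ⊢ <;> linarith

/-- For scalar codes, bandwidth and access cost agree. -/
theorem bandwidth_eq_accessCost {F : Type} [Field F]
    (X : MergeConvertibleCode F nI kI nF ς 1) : X.bandwidth = X.accessCost := by
  unfold bandwidth accessCost
  rw [Finset.card_filter, mul_one]
  congr 1
  refine Finset.sum_congr rfl fun x _ => ?_
  have := X.β_le x
  split_ifs <;> omega

end MergeConvertibleCode

/-! ### Vandermonde codes -/

open Polynomial in
/-- By the rearrangement inequality, the identity is the only permutation that contributes the
monomial of exponent `∑ i, a i * b i` to the determinant. -/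
theorem coeff_det_X_pow_mul {R : Type*} [CommRing R] {w : ℕ} {a b : Fin w → ℕ}
    (ha : StrictMono a) (hb : StrictMono b) :
    (Matrix.of fun i j => (X : R[X]) ^ (a i * b j)).det.coeff (∑ i, a i * b i) = 1 := by
  have hmono : Monovary a b := fun i j h => (ha (hb.lt_iff_lt.1 h)).le
  rw [Matrix.det_apply, finsetSum_coeff, Finset.sum_eq_single 1]
  · simp [Finset.prod_pow_eq_pow_sum]
  · intro σ _ hσ
    have hlt : ∑ i, a (σ i) * b i < ∑ i, a i * b i := by
      rw [hmono.sum_comp_perm_mul_lt_sum_mul_iff]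
      intro h
      apply hσ
      have hs : StrictMono σ := by
        intro i j hij
        have h1 := ha.le_iff_le.1 (h (hb hij))
        exact lt_of_le_of_ne h1 fun e => hij.ne (σ.injective e)
      exact Equiv.ext fun i => congrFun hs.eq_id i
    simp only [Matrix.of_apply, Finset.prod_pow_eq_pow_sum, coeff_smul, coeff_X_pow]
    rw [if_neg hlt.ne', smul_zero]
  · simp

open Polynomial in
theorem natDegree_det_X_pow_mul_le {R : Type*} [CommRing R] {w : ℕ} {a b : Fin w → ℕ} {N : ℕ}
    (h : ∀ i j, a i * b j ≤ N) :
    (Matrix.of fun i j => (X : R[X]) ^ (a i * b j)).det.natDegree ≤ w * N := by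
  rw [Matrix.det_apply]
  refine natDegree_sum_le_of_forall_le _ _ fun σ _ => (natDegree_smul_le _ _).trans ?_
  simp only [Matrix.of_apply, Finset.prod_pow_eq_pow_sum]
  refine (natDegree_X_pow_le _).trans ?_
  refine (Finset.sum_le_card_nsmul _ _ N fun i _ => h _ _).trans ?_
  simp

open Polynomial in
/-- A generator of the unit group of `𝔽_{p ^ D}` is a root of no nonzero polynomial of degree less
than `D` over the prime field, since it generates the field. -/
theorem aeval_ne_zero_of_generator {p D : ℕ} [Fact p.Prime] {F : Type*} [Field F] [Finite F]
    [Algebra (ZMod p) F] (hF : Nat.card F = p ^ D) {θ : Fˣ}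
    (hθ : ∀ x : Fˣ, x ∈ Subgroup.zpowers θ) {f : (ZMod p)[X]} (hf : f ≠ 0)
    (hD : f.natDegree < D) : aeval (θ : F) f ≠ 0 := by
  intro h0
  have hint : IsIntegral (ZMod p) (θ : F) := Algebra.IsIntegral.isIntegral _
  have htop : IntermediateField.adjoin (ZMod p) {(θ : F)} = ⊤ := by
    rw [eq_top_iff]
    intro x _
    rcases eq_or_ne x 0 with rfl | hx
    · exact zero_mem _
    · obtain ⟨n, hn⟩ := Subgroup.mem_zpowers_iff.1 (hθ (Units.mk0 x hx))
      have : x = (θ : F) ^ n := by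
        rw [← Units.val_zpow_eq_zpow_val, hn, Units.val_mk0]
      rw [this]
      exact zpow_mem (IntermediateField.mem_adjoin_simple_self _ _) n
  have hrank : Module.finrank (ZMod p) F = D := by
    have h := Module.natCard_eq_pow_finrank (K := ZMod p) (V := F)
    rw [hF, Nat.card_zmod] at h
    exact (Nat.pow_right_injective (Fact.out : p.Prime).two_le h).symm
  have hdeg := IntermediateField.adjoin.finrank hint
  rw [htop, IntermediateField.finrank_top', hrank] at hdeg
  have := natDegree_le_natDegree (minpoly.degree_le_of_ne_zero _ _ hf h0)
  omega

namespace VectorCode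

variable {F : Type} [Field F]

theorem vandermonde_encode_natAdd (θ : F) (k r : ℕ) (m : Fin k → Fin 1 → F) (i : Fin r)
    (t : Fin 1) : (vandermonde θ k r).encode m (Fin.natAdd k i) t =
      ∑ l : Fin k, θ ^ ((i : ℕ) * (l : ℕ)) * m l t :=
  congrFun (ofParities_encode_natAdd _ m i) t

theorem isSystematic_vandermonde (θ : F) (k r : ℕ) : (vandermonde θ k r).IsSystematic :=
  isSystematic_ofParities _

open Polynomial in
/-- The code is MDS if all minors of the parity matrix `θ ^ (i * l)` are nonzero. These minors are
the values at `θ` of nonzero polynomials of degree less than `k * r ^ 2`. -/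
theorem isMDS_vandermonde {K : Type} [Field K] [Algebra K F] (θ : F) {k r : ℕ} (hk : 0 < k)
    (hθ : ∀ f : K[X], f ≠ 0 → f.natDegree < k * r ^ 2 → aeval θ f ≠ 0) :
    (vandermonde θ k r).IsMDS := by
  classical
  refine isMDS_of_forall _ hk one_pos fun m S hS hm => ?_
  -- the unread systematic nodes are as many as the read parity nodes
  let A : Finset (Fin k) := Finset.univ.filter fun l => Fin.castAdd r l ∉ S
  let I : Finset (Fin r) := Finset.univ.filter fun i => Fin.natAdd k i ∈ S
  have hIA : I.card = A.card := by
    have h1 : S = (Finset.univ.filter fun l => Fin.castAdd r l ∈ S).map (Fin.castAddEmb r) ∪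
        I.map (Fin.natAddEmb k) := by
      ext y
      refine Fin.addCases (fun l => ?_) (fun i => ?_) y
      · have : ∀ i : Fin r, Fin.natAdd k i ≠ Fin.castAdd r l := fun i e => by
          have := congrArg Fin.val e
          simp only [Fin.val_natAdd, Fin.val_castAdd] at this
          omega
        simp [I, this]
      · have : ∀ l : Fin k, Fin.castAdd r l ≠ Fin.natAdd k i := fun l e => by
          have := congrArg Fin.val e
          simp only [Fin.val_natAdd, Fin.val_castAdd] at this
          omega
        simp [I, this]
    have h2 := congrArg Finset.card h1
    rw [Finset.card_union_of_disjoint, Finset.card_map, Finset.card_map, hS] at h2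
    · have h3 := Finset.card_filter_add_card_filter_not (s := Finset.univ)
        (fun l : Fin k => Fin.castAdd r l ∈ S)
      rw [Finset.card_univ, Fintype.card_fin] at h3
      change _ + A.card = k at h3
      omega
    · rw [Finset.disjoint_left]
      intro y hy hy'
      obtain ⟨l, -, rfl⟩ := Finset.mem_map.1 hy
      obtain ⟨i, -, e⟩ := Finset.mem_map.1 hy'
      have := congrArg Fin.val e
      simp only [Fin.natAddEmb_apply, Fin.castAddEmb_apply, Fin.val_natAdd, Fin.val_castAdd] at this
      omega
  have hzero : ∀ l ∉ A, m l = 0 := by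
    intro l hl
    have hl' : Fin.castAdd r l ∈ S := by simpa [A] using hl
    rw [← (isSystematic_vandermonde θ k r).encode_castAdd m l]
    exact hm _ hl'
  let a := I.orderEmbOfFin hIA
  let b := A.orderEmbOfFin rfl
  have hmul : (Matrix.of fun i j => θ ^ ((a i : ℕ) * (b j : ℕ))).mulVec
      (fun j => m (b j) 0) = 0 := by
    funext i
    have hi : Fin.natAdd k (a i) ∈ S := by
      have := I.orderEmbOfFin_mem hIA i
      exact (Finset.mem_filter.1 this).2
    have h1 := congrFun (hm _ hi) 0
    rw [vandermonde_encode_natAdd] at h1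
    rw [Pi.zero_apply] at h1
    rw [Matrix.mulVec, dotProduct, Pi.zero_apply, ← h1,
      ← Finset.sum_subset (Finset.subset_univ A) fun l _ hl => by rw [hzero l hl]; simp]
    rw [← Finset.sum_coe_sort A, ← (A.orderIsoOfFin rfl).toEquiv.sum_comp]
    rfl
  by_contra hne
  have hv : (fun j => m (b j) 0) ≠ 0 := by
    intro hv
    apply hne
    funext l t
    rw [Subsingleton.elim t 0]
    by_cases hl : l ∈ A
    · obtain ⟨j, hj⟩ : l ∈ Set.range b := by
        rw [Finset.range_orderEmbOfFin]
        exact hl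
      rw [← hj]
      exact congrFun hv j
    · rw [hzero l hl]
      rfl
  have hdet := Matrix.exists_mulVec_eq_zero_iff.1 ⟨_, hv, hmul⟩
  have hA : 0 < A.card := by
    by_contra h0
    exact hv (funext fun j => absurd j.2 (by omega))
  have hAr : A.card ≤ r := by
    rw [← hIA]
    simpa using Finset.card_le_univ I
  have hbound : ∀ i j, ((a i : Fin r) : ℕ) * ((b j : Fin k) : ℕ) ≤ r * k - 1 := fun i j => by
    have h1 := (a i).2
    have h2 := (b j).2
    have := Nat.mul_lt_mul'' h1 h2
    omega
  refine hθ (Matrix.of fun i j => (X : K[X]) ^ ((a i : ℕ) * (b j : ℕ))).det ?_ ?_ ?_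
  · intro h0
    have := coeff_det_X_pow_mul (R := K) (a := fun i => (a i : ℕ)) (b := fun j => (b j : ℕ))
      (fun _ _ h => a.strictMono h) (fun _ _ h => b.strictMono h)
    rw [h0] at this
    simp at this
  · refine (natDegree_det_X_pow_mul_le hbound).trans_lt ?_
    have hr : 0 < r := hA.trans_le hAr
    calc A.card * (r * k - 1) ≤ r * (r * k - 1) := Nat.mul_le_mul_right _ hAr
      _ < r * (r * k) := Nat.mul_lt_mul_of_pos_left (Nat.sub_lt (Nat.mul_pos hr hk) one_pos) hr
      _ = k * r ^ 2 := by ring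
  · rw [AlgHom.map_det, ← hdet]
    congr 1
    ext i j
    simp

/-- The Vandermonde code over `𝔽_{p ^ D}` is MDS if `D` is large. -/
theorem isMDS_vandermonde_of_generator {p D : ℕ} (hp : p.Prime) [Finite F]
    (hF : Nat.card F = p ^ D) {θ : Fˣ} (hθ : ∀ x : Fˣ, x ∈ Subgroup.zpowers θ) {k r : ℕ}
    (hk : 0 < k) (hD : k * r ^ 2 ≤ D) : (vandermonde (θ : F) k r).IsMDS := by
  have := Fact.mk hp
  have := Fintype.ofFinite F
  have : CharP F p := charP_of_card_eq_prime_pow (f := D) (by rw [← Nat.card_eq_fintype_card, hF])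
  let _ : Algebra (ZMod p) F := ZMod.algebra F p
  exact isMDS_vandermonde (K := ZMod p) _ hk fun f hf hdeg =>
    aeval_ne_zero_of_generator hF hθ hf (hdeg.trans_le hD)

end VectorCode

/-! ### Factorization of linear maps -/

/-- A linear map factors through every linear map with smaller kernel. -/
theorem LinearMap.exists_comp_eq_of_ker_le_ker {K U V W : Type*} [Field K] [AddCommGroup U]
    [Module K U] [AddCommGroup V] [Module K V] [AddCommGroup W] [Module K W]
    (f : V →ₗ[K] W) (g : V →ₗ[K] U) (h : LinearMap.ker g ≤ LinearMap.ker f) :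
    ∃ φ : U →ₗ[K] W, φ ∘ₗ g = f := by
  obtain ⟨φ, hφ⟩ := LinearMap.exists_extend
    ((LinearMap.ker g).liftQ f h ∘ₗ g.quotKerEquivRange.symm.toLinearMap)
  refine ⟨φ, LinearMap.ext fun v => ?_⟩
  have h1 := LinearMap.congr_fun hφ (g.quotKerEquivRange (Submodule.Quotient.mk v))
  simpa using h1

/-! ### Conversions that keep the systematic nodes -/

namespace MergeConvertibleCode

variable {F : Type} [Field F] {kI rI rF ς α : ℕ}

section SystematicConversion

variable (CI : VectorCode F (kI + rI) kI α) (CF : VectorCode F (ς * kI + rF) (ς * kI) α)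
  (hI : CI.IsSystematic) (hF : CF.IsSystematic) (e : Fin ς × Fin kI ≃ Fin (ς * kI))
  (J : Fin ς × Fin (kI + rI) → Finset (Fin α))
  (L : (Fin ς × Fin (kI + rI) → Fin α → F) →ₗ[F] (Fin rF → Fin α → F))

/-- The origin of final nodes, if exactly the systematic nodes are kept. -/
def systematicOrigin (rI rF : ℕ) (e : Fin ς × Fin kI ≃ Fin (ς * kI)) (y : Fin (ς * kI + rF)) :
    Option (Fin ς × Fin (kI + rI)) :=
  Fin.addCases (motive := fun _ => Option (Fin ς × Fin (kI + rI)))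
    (fun l => some ((e.symm l).1, Fin.castAdd rI (e.symm l).2)) (fun _ => none) y

theorem systematicOrigin_castAdd (l : Fin (ς * kI)) :
    systematicOrigin rI rF e (Fin.castAdd rF l) =
      some ((e.symm l).1, Fin.castAdd rI (e.symm l).2) := by
  simp [systematicOrigin]

theorem systematicOrigin_natAdd (i : Fin rF) :
    systematicOrigin rI rF e (Fin.natAdd (ς * kI) i) = none := by
  simp [systematicOrigin]

/-- The downloaded subsymbols put back in their places, with `0` for the other subsymbols. -/
noncomputable def placeDownloads :
    (∀ x, Fin (J x).card → F) →ₗ[F] (Fin ς × Fin (kI + rI) → Fin α → F) where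
  toFun d x j := if h : j ∈ J x then d x ((J x).equivFin ⟨j, h⟩) else 0
  map_add' d d' := by
    funext x j
    by_cases hj : j ∈ J x <;> simp [hj]
  map_smul' a d := by
    funext x j
    by_cases hj : j ∈ J x <;> simp [hj]

/-- The parities computed from the downloaded data. There is nothing to compute for the systematic
final nodes, which get the value `0`. -/
noncomputable def convertDownloads :
    (∀ x, Fin (J x).card → F) →ₗ[F] (Fin (ς * kI + rF) → Fin α → F) :=
  LinearMap.pi fun y =>
    Fin.addCases (motive := fun _ => (∀ x, Fin (J x).card → F) →ₗ[F] (Fin α → F)) (fun _ => 0)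
      (fun i => LinearMap.proj i ∘ₗ L ∘ₗ placeDownloads J) y

/-- The conversion of systematic codes that keeps the systematic nodes, reads the subsymbols
`J x` of each initial node `x`, and computes the parities by applying the linear map `L` to the
subsymbols read, where subsymbols that are not read are replaced by `0`. -/
noncomputable def systematicConversion
    (hL : ∀ m i, L (fun x j => if j ∈ J x then CI.encode (fun l => m (e (x.1, l))) x.2 j else 0) i
      = CF.encode m (Fin.natAdd (ς * kI) i)) :
    MergeConvertibleCode F (kI + rI) kI (ς * kI + rF) ς α where
  initialCode := CI
  finalCode := CF
  partition := e
  origin := systematicOrigin rI rF e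
  origin_inj := by
    intro y y' x
    refine Fin.addCases (fun l => ?_) (fun i => ?_) y
    · refine Fin.addCases (fun l' => ?_) (fun i' => ?_) y'
      · intro h h'
        rw [systematicOrigin_castAdd] at h h'
        have h2 := h.trans h'.symm
        simp only [Option.some.injEq, Prod.mk.injEq, Fin.castAdd_inj] at h2
        rw [e.symm.injective (Prod.ext h2.1 h2.2)]
      · intro _ h'
        rw [systematicOrigin_natAdd] at h'
        cases h'
    · intro h
      rw [systematicOrigin_natAdd] at h
      cases h
  unchanged_eq := by
    intro m y s x
    refine Fin.addCases (fun l h => ?_) (fun i h => ?_) y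
    · rw [systematicOrigin_castAdd] at h
      simp only [Option.some.injEq, Prod.mk.injEq] at h
      rw [← h.2, hI.encode_castAdd, hF.encode_castAdd, ← h.1, Prod.mk.eta, e.apply_symm_apply]
    · rw [systematicOrigin_natAdd] at h
      cases h
  β x := (J x).card
  β_le x := by simpa using Finset.card_le_univ (J x)
  download x v t := v ((J x).equivFin.symm t)
  convert d y := convertDownloads J L d y.1
  convert_eq := by
    rintro m ⟨y, hy⟩
    revert hy
    refine Fin.addCases (fun l h => ?_) (fun i h => ?_) y
    · rw [systematicOrigin_castAdd] at h
      cases h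
    · rw [← hL, convertDownloads, LinearMap.pi_apply, Fin.addCases_right]
      refine congrArg (fun z => L z i) ?_
      funext x j
      simp [placeDownloads]

variable {CI CF hI hF e J L}
  {hL : ∀ m i, L (fun x j => if j ∈ J x then CI.encode (fun l => m (e (x.1, l))) x.2 j else 0) i
      = CF.encode m (Fin.natAdd (ς * kI) i)}

theorem systematicConversion_isLinear :
    (systematicConversion CI CF hI hF e J L hL).IsLinear := by
  refine ⟨fun x => ⟨fun _ _ => rfl, fun _ _ => rfl⟩, ⟨fun d d' => ?_, fun a d => ?_⟩⟩
  · funext y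
    exact congrFun ((convertDownloads J L).map_add d d') y.1
  · funext y
    exact congrFun ((convertDownloads J L).map_smul a d) y.1

theorem systematicConversion_isUnchanged (s : Fin ς) (l : Fin kI) :
    (systematicConversion CI CF hI hF e J L hL).IsUnchanged (s, Fin.castAdd rI l) :=
  ⟨Fin.castAdd rF (e (s, l)), by
    change systematicOrigin rI rF e _ = _
    rw [systematicOrigin_castAdd, e.symm_apply_apply]⟩

theorem systematicConversion_isRetired (s : Fin ς) (i : Fin rI) :
    (systematicConversion CI CF hI hF e J L hL).IsRetired (s, Fin.natAdd kI i) := by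
  rintro ⟨y, hy⟩
  change systematicOrigin rI rF e y = _ at hy
  revert hy
  refine Fin.addCases (fun l h => ?_) (fun i h => ?_) y
  · rw [systematicOrigin_castAdd] at h
    simp only [Option.some.injEq, Prod.mk.injEq] at h
    have := congrArg Fin.val h.2
    simp only [Fin.val_natAdd, Fin.val_castAdd] at this
    omega
  · rw [systematicOrigin_natAdd] at h
    cases h

theorem systematicConversion_downloadsSubsymbols (x : Fin ς × Fin (kI + rI)) :
    (systematicConversion CI CF hI hF e J L hL).DownloadsSubsymbols x (J x) :=
  ⟨(J x).equivFin.symm, fun _ _ => rfl⟩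

theorem systematicConversion_newCount :
    (systematicConversion CI CF hI hF e J L hL).newCount = rF := by
  have h : (Finset.univ.filter fun y => (systematicOrigin rI rF e y).isNone) =
      Finset.univ.map (Fin.natAddEmb (ς * kI)) := by
    ext y
    refine Fin.addCases (fun l => ?_) (fun i => ?_) y
    · have : ∀ i : Fin rF, Fin.natAdd (ς * kI) i ≠ Fin.castAdd rF l := fun i h => by
        have := congrArg Fin.val h
        simp only [Fin.val_natAdd, Fin.val_castAdd] at this
        omega
      simp [systematicOrigin_castAdd, this]
    · simp [systematicOrigin_natAdd]
  refine (congrArg Finset.card h).trans ?_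
  rw [Finset.card_map, Finset.card_univ, Fintype.card_fin]

theorem systematicConversion_bandwidth :
    (systematicConversion CI CF hI hF e J L hL).bandwidth =
      ∑ s, (∑ l, (J (s, Fin.castAdd rI l)).card + ∑ i, (J (s, Fin.natAdd kI i)).card)
        + rF * α := by
  unfold bandwidth
  rw [systematicConversion_newCount, Fintype.sum_prod_type]
  congr 1
  refine Finset.sum_congr rfl fun s _ => ?_
  rw [Fin.sum_univ_add]
  rfl

end SystematicConversion

/-- Systematic codes can always be converted by reading all systematic nodes. -/
theorem exists_conversion_reading_systematic (CI : VectorCode F (kI + rI) kI α)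
    (CF : VectorCode F (ς * kI + rF) (ς * kI) α) (hI : CI.IsSystematic) (hF : CF.IsSystematic) :
    ∃ X : MergeConvertibleCode F (kI + rI) kI (ς * kI + rF) ς α,
      X.initialCode = CI ∧ X.finalCode = CF ∧ X.bandwidth = ς * kI * α + rF * α := by
  let e : Fin ς × Fin kI ≃ Fin (ς * kI) := finProdFinEquiv
  let J : Fin ς × Fin (kI + rI) → Finset (Fin α) := fun x =>
    Fin.addCases (motive := fun _ => Finset (Fin α)) (fun _ => Finset.univ) (fun _ => ∅) x.2
  let L : (Fin ς × Fin (kI + rI) → Fin α → F) →ₗ[F] (Fin rF → Fin α → F) :=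
    LinearMap.pi fun i => LinearMap.proj (Fin.natAdd (ς * kI) i) ∘ₗ CF.encode ∘ₗ
      LinearMap.pi fun l => LinearMap.proj ((e.symm l).1, Fin.castAdd rI (e.symm l).2)
  refine ⟨systematicConversion CI CF hI hF e J L fun m i => ?_, rfl, rfl, ?_⟩
  · change CF.encode _ _ = _
    refine congrArg (fun m => CF.encode m (Fin.natAdd (ς * kI) i)) ?_
    funext l j
    simp [J, hI.encode_castAdd]
  · rw [systematicConversion_bandwidth]
    simp [J, mul_assoc]

/-- Restricted to a block of consecutive message symbols, the parities of the long Vandermonde code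
are multiples of those of the short one. Hence conversion only needs `rF` initial parities. -/
theorem exists_conversion_vandermonde (θ : F) (kI ς : ℕ) (h : rF ≤ rI) :
    ∃ X : MergeConvertibleCode F (kI + rI) kI (ς * kI + rF) ς 1,
      X.initialCode = VectorCode.vandermonde θ kI rI ∧
      X.finalCode = VectorCode.vandermonde θ (ς * kI) rF ∧
      X.partition = finProdFinEquiv ∧
      (∀ s l, X.β (s, Fin.castAdd rI l) = 0) ∧ X.bandwidth = ς * rF + rF := by
  let J : Fin ς × Fin (kI + rI) → Finset (Fin 1) := fun x =>
    Fin.addCases (motive := fun _ => Finset (Fin 1)) (fun _ => ∅)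
      (fun i => if (i : ℕ) < rF then Finset.univ else ∅) x.2
  let L : (Fin ς × Fin (kI + rI) → Fin 1 → F) →ₗ[F] (Fin rF → Fin 1 → F) :=
    LinearMap.pi fun i => ∑ s : Fin ς, θ ^ ((i : ℕ) * (kI * s)) •
      LinearMap.proj (s, Fin.natAdd kI (Fin.castLE h i))
  refine ⟨systematicConversion _ _ (VectorCode.isSystematic_vandermonde θ kI rI)
    (VectorCode.isSystematic_vandermonde θ (ς * kI) rF) finProdFinEquiv J L fun m i => ?_,
    rfl, rfl, rfl, fun s l => ?_, ?_⟩
  · funext t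
    rw [VectorCode.vandermonde_encode_natAdd, ← finProdFinEquiv.sum_comp, Fintype.sum_prod_type]
    simp only [L, LinearMap.pi_apply, LinearMap.sum_apply, LinearMap.smul_apply,
      LinearMap.proj_apply, Finset.sum_apply, Pi.smul_apply, smul_eq_mul]
    refine Finset.sum_congr rfl fun s _ => ?_
    rw [if_pos (by simp [J, Subsingleton.elim t 0]), VectorCode.vandermonde_encode_natAdd,
      Finset.mul_sum]
    refine Finset.sum_congr rfl fun l _ => ?_
    rw [← mul_assoc, ← pow_add]
    congr 2
    simp only [finProdFinEquiv_apply_val, Fin.val_castLE]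
    ring
  · change (J (s, Fin.castAdd rI l)).card = 0
    simp [J]
  · rw [systematicConversion_bandwidth]
    have hc : (Finset.univ.filter fun i : Fin rI => (i : ℕ) < rF).card = rF := by
      rw [Fin.card_filter_val_lt, min_eq_right h]
    have : ∀ i : Fin rI, (if (i : ℕ) < rF then (Finset.univ : Finset (Fin 1)) else ∅).card =
        if (i : ℕ) < rF then 1 else 0 := fun i => by split_ifs <;> simp
    simp only [J, Fin.addCases_left, Fin.addCases_right, this, Finset.sum_boole, hc]
    simp

/-! ### Conversions that read parities only -/

/-- If conversion reads initial parities only, then the final parities are linear functions of the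
initial parities. Indeed, every final parity depends on all initial codewords, hence is a new node,
and therefore vanishes whenever all initial parities do. -/
theorem exists_linear_of_reads_parities {rP : ℕ}
    (B : MergeConvertibleCode F (kI + rP) kI (ς * kI + rF) ς 1) (hMDS : B.finalCode.IsMDS)
    (hF : B.finalCode.IsSystematic) (hβ : ∀ s l, B.β (s, Fin.castAdd rP l) = 0)
    (hk : 1 ≤ kI) (hς : 2 ≤ ς) :
    ∃ g : (Fin ς × Fin rP → F) →ₗ[F] (Fin rF → F), ∀ (u : Fin (ς * kI) → F) (i : Fin rF),
      g (fun x => B.initialCode.scalarEncode (Fin.natAdd kI x.2)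
        (fun l => u (B.partition (x.1, l)))) i =
      B.finalCode.scalarEncode (Fin.natAdd (ς * kI) i) u := by
  classical
  have hnew : ∀ i : Fin rF, B.origin (Fin.natAdd (ς * kI) i) = none := by
    intro i
    rcases hor : B.origin (Fin.natAdd (ς * kI) i) with _ | ⟨s, x⟩
    · rfl
    exfalso
    obtain ⟨t, ht⟩ : ∃ t : Fin ς, t ≠ s := by
      have : Nontrivial (Fin ς) := Fin.nontrivial_iff_two_le.2 hς
      exact exists_ne s
    -- a message with a single nonzero symbol, outside of codeword `s`
    let l₀ : Fin (ς * kI) := B.partition (t, ⟨0, hk⟩)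
    let m : Fin (ς * kI) → Fin 1 → F := Pi.single l₀ 1
    have hm : m = 0 := by
      refine hMDS.eq_zero (S := insert (Fin.natAdd (ς * kI) i)
        ((Finset.univ.erase l₀).map (Fin.castAddEmb rF))) ?_ fun y hy => ?_
      · have hcard := Finset.card_erase_add_one (Finset.mem_univ l₀)
        rw [Finset.card_univ, Fintype.card_fin] at hcard
        rw [Finset.card_insert_of_notMem, Finset.card_map, hcard]
        intro hmem
        obtain ⟨l, -, hl⟩ := Finset.mem_map.1 hmem
        have := congrArg Fin.val hl
        simp only [Fin.castAddEmb_apply, Fin.val_natAdd, Fin.val_castAdd] at this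
        omega
      · rcases Finset.mem_insert.1 hy with rfl | hy
        · rw [B.unchanged_eq m _ s x hor]
          have : (fun l => m (B.partition (s, l))) = 0 := by
            funext l
            have hne : B.partition (s, l) ≠ l₀ := fun h =>
              ht (congrArg Prod.fst (B.partition.injective h)).symm
            exact Pi.single_eq_of_ne hne _
          rw [this, map_zero, Pi.zero_apply]
        · obtain ⟨l, hl, rfl⟩ := Finset.mem_map.1 hy
          exact (hF.encode_castAdd m l).trans (Pi.single_eq_of_ne (Finset.ne_of_mem_erase hl) _)
    have h1 : m l₀ = 1 := Pi.single_eq_same _ _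
    rw [hm] at h1
    exact zero_ne_one (congrFun h1 0)
  let f : (Fin (ς * kI) → F) →ₗ[F] (Fin rF → F) :=
    LinearMap.pi fun i => B.finalCode.scalarEncode (Fin.natAdd (ς * kI) i)
  let p : (Fin (ς * kI) → F) →ₗ[F] (Fin ς × Fin rP → F) :=
    LinearMap.pi fun x => B.initialCode.scalarEncode (Fin.natAdd kI x.2) ∘ₗ
      LinearMap.pi fun l => LinearMap.proj (B.partition (x.1, l))
  obtain ⟨g, hg⟩ := f.exists_comp_eq_of_ker_le_ker p (by
    intro u hu
    rw [LinearMap.mem_ker] at hu ⊢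
    funext i
    have h := B.encode_eq_of_download_eq (m := fun l _ => u l) (m' := 0) (hnew i) (by
      intro s x
      refine Fin.addCases (fun l => ?_) (fun i => ?_) x
      · funext t
        exact absurd t.pos (hβ s l).not_gt
      · congr 1
        funext t
        rw [VectorCode.encode_eq_scalarEncode, VectorCode.encode_eq_scalarEncode]
        exact (congrFun hu (s, i)).trans (map_zero (B.initialCode.scalarEncode _)).symm)
    rw [map_zero] at h
    exact congrFun h 0)
  exact ⟨g, fun u i => congrFun (LinearMap.congr_fun hg u) i⟩

/-! ### Conversion of piggybacked codes -/

/-- The parities of instance `j` of the base code, recovered from what is read of the piggybacked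
code. For `j ≥ rI` they are computed from the systematic nodes. For `j < rI`, parity `i < rI` is
read directly, while parity `i ≥ rI` is the piggyback in coordinate `i` of parity `j`. -/
def recoverParities (C : VectorCode F (kI + rF) kI 1) (ς : ℕ) (rI : ℕ) (j : Fin rF) :
    (Fin ς × Fin (kI + rI) → Fin rF → F) →ₗ[F] (Fin ς × Fin rF → F) :=
  LinearMap.pi fun x =>
    if hj : rI ≤ (j : ℕ) then
      C.scalarEncode (Fin.natAdd kI x.2) ∘ₗ LinearMap.pi fun l =>
        (LinearMap.proj j : (Fin rF → F) →ₗ[F] F) ∘ₗ LinearMap.proj (x.1, Fin.castAdd rI l)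
    else if hi : (x.2 : ℕ) < rI then
      (LinearMap.proj j : (Fin rF → F) →ₗ[F] F) ∘ₗ LinearMap.proj (x.1, Fin.natAdd kI ⟨x.2, hi⟩)
    else
      (LinearMap.proj x.2 : (Fin rF → F) →ₗ[F] F) ∘ₗ
          LinearMap.proj (x.1, Fin.natAdd kI ⟨j, not_le.1 hj⟩) -
        C.scalarEncode (Fin.natAdd kI j) ∘ₗ LinearMap.pi fun l =>
          (LinearMap.proj x.2 : (Fin rF → F) →ₗ[F] F) ∘ₗ LinearMap.proj (x.1, Fin.castAdd rI l)

/-- The subsymbols read in the conversion of the piggybacked code. -/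
def piggybackReads (kI rI rF : ℕ) (x : Fin ς × Fin (kI + rI)) : Finset (Fin rF) :=
  Fin.addCases (motive := fun _ => Finset (Fin rF))
    (fun _ => Finset.univ.filter fun j : Fin rF => rI ≤ (j : ℕ)) (fun _ => Finset.univ) x.2

theorem piggybackReads_castAdd (s : Fin ς) (l : Fin kI) :
    piggybackReads kI rI rF (s, Fin.castAdd rI l) =
      Finset.univ.filter fun j : Fin rF => rI ≤ (j : ℕ) := by
  simp [piggybackReads]

theorem piggybackReads_natAdd (s : Fin ς) (i : Fin rI) :
    piggybackReads kI rI rF (s, Fin.natAdd kI i) = Finset.univ := by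
  simp [piggybackReads]

theorem card_filter_le_val (rI rF : ℕ) :
    (Finset.univ.filter fun j : Fin rF => rI ≤ (j : ℕ)).card = rF - rI := by
  have h := Finset.card_filter_add_card_filter_not (s := Finset.univ)
    (fun j : Fin rF => (j : ℕ) < rI)
  simp only [not_lt, Fin.card_filter_val_lt, Finset.card_univ, Fintype.card_fin] at h
  omega

/-- The subsymbols that are read of a piggybacked codeword determine all parities of all instances
of the base code, the punctured ones included. -/
theorem recoverParities_piggyback (C : VectorCode F (kI + rF) kI 1)
    (h : rI ≤ rF) (m : Fin ς → Fin kI → Fin rF → F) (j : Fin rF) (x : Fin ς × Fin rF) :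
    recoverParities C ς rI j (fun x j' => if j' ∈ piggybackReads kI rI rF x then
      (C.piggyback h).encode (m x.1) x.2 j' else 0) x =
      C.scalarEncode (Fin.natAdd kI x.2) (fun l => m x.1 l j) := by
  have hsys : ∀ j' : Fin rF, rI ≤ (j' : ℕ) → (fun l : Fin kI =>
      if j' ∈ piggybackReads kI rI rF (x.1, Fin.castAdd rI l) then
        (C.piggyback h).encode (m x.1) (Fin.castAdd rI l) j' else 0) = fun l => m x.1 l j' := by
    intro j' hj'
    funext l
    rw [piggybackReads_castAdd, if_pos (by simpa using hj'),
      (C.isSystematic_piggyback h).encode_castAdd]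
  unfold recoverParities
  rw [LinearMap.pi_apply]
  split_ifs with hj hi
  · exact congrArg (C.scalarEncode _) (hsys j hj)
  · change (if j ∈ piggybackReads kI rI rF (x.1, Fin.natAdd kI ⟨x.2, hi⟩) then
      (C.piggyback h).encode (m x.1) (Fin.natAdd kI ⟨x.2, hi⟩) j else 0) = _
    rw [piggybackReads_natAdd, if_pos (Finset.mem_univ _), VectorCode.piggyback_encode_natAdd,
      if_neg hj, add_zero]
    rfl
  · have hx : rI ≤ (x.2 : ℕ) := not_lt.1 hi
    rw [LinearMap.sub_apply]
    refine sub_eq_of_eq_add ?_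
    refine Eq.trans ?_ (congrArg (C.scalarEncode (Fin.natAdd kI x.2) (fun l => m x.1 l j) + ·)
      (congrArg (C.scalarEncode (Fin.natAdd kI j)) (hsys x.2 hx)).symm)
    change (if x.2 ∈ piggybackReads kI rI rF (x.1, Fin.natAdd kI ⟨j, not_le.1 hj⟩) then
      (C.piggyback h).encode (m x.1) (Fin.natAdd kI ⟨j, not_le.1 hj⟩) x.2 else 0) = _
    rw [piggybackReads_natAdd, if_pos (Finset.mem_univ _), VectorCode.piggyback_encode_natAdd,
      if_pos hx, add_comm]
    rfl

end MergeConvertibleCode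

/-! ### Optimal convertible codes -/

namespace MergeConvertibleCode

variable {F : Type} [Field F] {kI rI rF ς : ℕ}

/-- A scalar code whose access cost equals the bound is access-optimal. -/
theorem isAccessOptimal_of_bandwidth_eq (X : MergeConvertibleCode F (kI + rI) kI (ς * kI + rF) ς 1)
    (hX : X.IsMDS) (hk : 1 ≤ kI) (hς : 2 ≤ ς)
    (hb : (X.bandwidth : ℚ) = mergeBandwidthBound kI rI rF ς 1) : X.IsAccessOptimal := by
  refine ⟨hX, fun K _ _ Y hY => ?_⟩
  rw [← bandwidth_eq_accessCost, ← bandwidth_eq_accessCost]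
  have h := Y.mergeBandwidthBound_le_bandwidth hY.2 hk hς
  rw [← hb] at h
  exact_mod_cast h

/-- Piggybacking of a base code. The data read determine the initial parities of every instance of
the base code, and linear conversion of the base code turns these into the final parities. -/
theorem exists_piggyback [Finite F] (hk : 1 ≤ kI) (hς : 2 ≤ ς) (h : rI < rF) (hr : rF < kI)
    (B : MergeConvertibleCode F (kI + rF) kI (ς * kI + rF) ς 1) (hB : B.IsBase) :
    ∃ X : MergeConvertibleCode F (kI + rI) kI (ς * kI + rF) ς rF,
      X.initialCode = B.initialCode.piggyback h.le ∧
      X.finalCode = B.finalCode.instances rF ∧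
      X.partition = B.partition ∧
      X.IsMDS ∧ X.IsLinear ∧
      (∀ (s : Fin ς) (l : Fin kI), X.IsUnchanged (s, Fin.castAdd rI l) ∧
        X.DownloadsSubsymbols (s, Fin.castAdd rI l)
          (Finset.univ.filter fun j : Fin rF => rI ≤ (j : ℕ)) ∧
        X.β (s, Fin.castAdd rI l) = rF - rI) ∧
      (∀ (s : Fin ς) (i : Fin rI), X.IsRetired (s, Fin.natAdd kI i) ∧
        X.DownloadsSubsymbols (s, Fin.natAdd kI i) Finset.univ ∧
        X.β (s, Fin.natAdd kI i) = rF) ∧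
      (X.bandwidth : ℚ) = mergeBandwidthBound kI rI rF ς rF := by
  obtain ⟨⟨hMDS, -⟩, hI, hF, hβ⟩ := hB
  have hrF : 0 < rF := (Nat.zero_le _).trans_lt h
  have hςk : 0 < ς * kI := Nat.mul_pos (by omega) hk
  obtain ⟨g, hg⟩ := B.exists_linear_of_reads_parities hMDS.2 hF hβ hk hς
  let L : (Fin ς × Fin (kI + rI) → Fin rF → F) →ₗ[F] (Fin rF → Fin rF → F) :=
    LinearMap.pi fun i => LinearMap.pi fun j =>
      (LinearMap.proj i : (Fin rF → F) →ₗ[F] F) ∘ₗ g ∘ₗ recoverParities B.initialCode ς rI j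
  have hL : ∀ m i, L (fun x j => if j ∈ piggybackReads kI rI rF x then
      (B.initialCode.piggyback h.le).encode (fun l => m (B.partition (x.1, l))) x.2 j else 0) i =
      (B.finalCode.instances rF).encode m (Fin.natAdd (ς * kI) i) := by
    intro m i
    funext j
    refine Eq.trans ?_ (hg (fun l => m l j) i)
    refine congrArg (fun q => g q i) (funext fun x => ?_)
    exact recoverParities_piggyback B.initialCode h.le
      (fun s l => m (B.partition (s, l))) j x
  let X := systematicConversion _ _ (B.initialCode.isSystematic_piggyback h.le) (hF.instances rF)
    B.partition (piggybackReads kI rI rF) L hL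
  have hXβ : ∀ x, X.β x = (piggybackReads kI rI rF x).card := fun _ => rfl
  refine ⟨X, rfl, rfl, rfl, ⟨hMDS.1.piggyback hI h.le hk hrF, hMDS.2.instances hςk hrF⟩,
    systematicConversion_isLinear, fun s l => ⟨systematicConversion_isUnchanged s l, ?_, ?_⟩,
    fun s i => ⟨systematicConversion_isRetired s i, ?_, ?_⟩, ?_⟩
  · rw [← piggybackReads_castAdd s l]
    exact systematicConversion_downloadsSubsymbols _
  · rw [hXβ, piggybackReads_castAdd, card_filter_le_val]
  · rw [← piggybackReads_natAdd s i]
    exact systematicConversion_downloadsSubsymbols _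
  · rw [hXβ, piggybackReads_natAdd, Finset.card_univ, Fintype.card_fin]
  · have hb : X.bandwidth = _ := systematicConversion_bandwidth
    simp only [piggybackReads_castAdd, piggybackReads_natAdd, card_filter_le_val,
      Finset.card_univ, Fintype.card_fin, Finset.sum_const, smul_eq_mul] at hb
    have hrFq : (rF : ℚ) ≠ 0 := by exact_mod_cast hrF.ne'
    rw [hb, mergeBandwidthBound, if_neg (by omega)]
    push_cast [h.le]
    field_simp
    ring

/-- The Vandermonde codes of a generator of a large enough field form a base code. -/
theorem exists_isBase_vandermonde [Finite F] (hk : 1 ≤ kI) (hς : 2 ≤ ς) (hr : rF < kI)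
    {p D : ℕ} (hp : p.Prime) (hD : ς * kI * rF ^ 2 ≤ D) (hF : Nat.card F = p ^ D) (θ : Fˣ)
    (hθ : ∀ x : Fˣ, x ∈ Subgroup.zpowers θ) :
    ∃ B : MergeConvertibleCode F (kI + rF) kI (ς * kI + rF) ς 1,
      B.initialCode = VectorCode.vandermonde (θ : F) kI rF ∧
      B.finalCode = VectorCode.vandermonde (θ : F) (ς * kI) rF ∧
      B.partition = finProdFinEquiv ∧
      B.IsBase := by
  obtain ⟨B, hBI, hBF, hBp, hβ, hb⟩ := exists_conversion_vandermonde (θ : F) kI ς (le_refl rF)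
  have hkD : kI * rF ^ 2 ≤ D :=
    (Nat.mul_le_mul_right _ (Nat.le_mul_of_pos_left kI (by omega))).trans hD
  have hMDS : B.IsMDS := by
    unfold IsMDS
    rw [hBI, hBF]
    exact ⟨VectorCode.isMDS_vandermonde_of_generator hp hF hθ hk hkD,
      VectorCode.isMDS_vandermonde_of_generator hp hF hθ (Nat.mul_pos (by omega) hk) hD⟩
  refine ⟨B, hBI, hBF, hBp, B.isAccessOptimal_of_bandwidth_eq hMDS hk hς ?_, ?_, ?_, hβ⟩
  · rw [hb, mergeBandwidthBound, if_pos (Or.inl le_rfl), min_eq_right (by exact_mod_cast hr.le)]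
    push_cast
    ring
  · rw [hBI]
    exact VectorCode.isSystematic_vandermonde _ _ _
  · rw [hBF]
    exact VectorCode.isSystematic_vandermonde _ _ _

end MergeConvertibleCode

theorem exists_field_card_eq_two_pow (D : ℕ) : ∃ (F : Type) (_ : Field F) (_ : Finite F) (θ : Fˣ),
    Nat.card F = 2 ^ (D + 1) ∧ ∀ x : Fˣ, x ∈ Subgroup.zpowers θ := by
  have : Finite (GaloisField 2 (D + 1)) :=
    Nat.finite_of_card_ne_zero (by rw [GaloisField.card 2 (D + 1) D.succ_ne_zero]; positivity)
  obtain ⟨θ, hθ⟩ := IsCyclic.exists_generator (α := (GaloisField 2 (D + 1))ˣ)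
  exact ⟨GaloisField 2 (D + 1), inferInstance, this, θ,
    GaloisField.card 2 (D + 1) D.succ_ne_zero, hθ⟩

namespace MergeConvertibleCode

/-- Outside of the range of piggybacking, scalar codes attain the bound: conversion reads all
systematic nodes if `kI ≤ rF`, and `rF` parities of each initial codeword otherwise. -/
theorem exists_scalar_bandwidth_eq {kI rI rF ς : ℕ} (hk : 1 ≤ kI) (hς : 2 ≤ ς)
    (h : rF ≤ rI ∨ kI ≤ rF) :
    ∃ (F : Type) (_ : Field F) (_ : Finite F)
      (X : MergeConvertibleCode F (kI + rI) kI (ς * kI + rF) ς 1), X.IsMDS ∧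
      (X.bandwidth : ℚ) = mergeBandwidthBound kI rI rF ς 1 := by
  let D := kI * rI ^ 2 + ς * kI * rF ^ 2
  obtain ⟨F, _, _, θ, hF, hθ⟩ := exists_field_card_eq_two_pow D
  have h1 : (VectorCode.vandermonde (θ : F) kI rI).IsMDS :=
    VectorCode.isMDS_vandermonde_of_generator Nat.prime_two hF hθ hk
      ((Nat.le_add_right _ _).trans (Nat.le_succ D))
  have h2 : (VectorCode.vandermonde (θ : F) (ς * kI) rF).IsMDS :=
    VectorCode.isMDS_vandermonde_of_generator Nat.prime_two hF hθ (Nat.mul_pos (by omega) hk)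
      ((Nat.le_add_left _ _).trans (Nat.le_succ D))
  refine ⟨F, inferInstance, inferInstance, ?_⟩
  rw [mergeBandwidthBound, if_pos h]
  rcases le_or_gt kI rF with hkr | hkr
  · obtain ⟨X, hI, hX, hb⟩ := exists_conversion_reading_systematic _ _
      (VectorCode.isSystematic_vandermonde (θ : F) kI rI)
      (VectorCode.isSystematic_vandermonde (θ : F) (ς * kI) rF)
    refine ⟨X, ⟨hI ▸ h1, hX ▸ h2⟩, ?_⟩
    rw [hb, min_eq_left (by exact_mod_cast hkr)]
    push_cast
    ring
  · obtain ⟨X, hI, hX, -, -, hb⟩ := exists_conversion_vandermonde (θ : F) kI ς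
      (h.resolve_right (not_le.2 hkr))
    refine ⟨X, ⟨hI ▸ h1, hX ▸ h2⟩, ?_⟩
    rw [hb, min_eq_right (by exact_mod_cast hkr.le)]
    push_cast
    ring

end MergeConvertibleCode

theorem mainTheorem2 (kI rI rF ς : ℕ) (hk : 1 ≤ kI) (hς : 2 ≤ ς) :
    -- the piggybacking construction, applied to any base code
    (∀ (h : rI < rF), rF < kI →
      ∀ (F : Type) [Field F] [Finite F]
        (B : MergeConvertibleCode F (kI + rF) kI (ς * kI + rF) ς 1), B.IsBase →
        ∃ X : MergeConvertibleCode F (kI + rI) kI (ς * kI + rF) ς rF,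
          X.initialCode = B.initialCode.piggyback h.le ∧
          X.finalCode = B.finalCode.instances rF ∧
          X.partition = B.partition ∧
          X.IsMDS ∧ X.IsLinear ∧
          (∀ (s : Fin ς) (l : Fin kI), X.IsUnchanged (s, Fin.castAdd rI l) ∧
            X.DownloadsSubsymbols (s, Fin.castAdd rI l)
              (Finset.univ.filter fun j : Fin rF => rI ≤ (j : ℕ)) ∧
            X.β (s, Fin.castAdd rI l) = rF - rI) ∧
          (∀ (s : Fin ς) (i : Fin rI), X.IsRetired (s, Fin.natAdd kI i) ∧
            X.DownloadsSubsymbols (s, Fin.natAdd kI i) Finset.univ ∧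
            X.β (s, Fin.natAdd kI i) = rF) ∧
          (X.bandwidth : ℚ) = mergeBandwidthBound kI rI rF ς rF) ∧
    -- explicit base codes
    (rI < rF → rF < kI →
      ∀ (p D : ℕ), p.Prime → ς * kI * rF ^ 2 ≤ D →
      ∀ (F : Type) [Field F] [Finite F], Nat.card F = p ^ D →
      ∀ θ : Fˣ, (∀ x : Fˣ, x ∈ Subgroup.zpowers θ) →
        ∃ B : MergeConvertibleCode F (kI + rF) kI (ς * kI + rF) ς 1,
          B.initialCode = VectorCode.vandermonde (θ : F) kI rF ∧
          B.finalCode = VectorCode.vandermonde (θ : F) (ς * kI) rF ∧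
          B.partition = finProdFinEquiv ∧
          B.IsBase) ∧
    -- access-optimal codes attain the bound in the remaining cases
    (rF ≤ rI ∨ kI ≤ rF →
      (∃ (F : Type) (_ : Field F) (_ : Finite F)
        (X : MergeConvertibleCode F (kI + rI) kI (ς * kI + rF) ς 1), X.IsAccessOptimal) ∧
      ∀ (F : Type) [Field F] [Finite F]
        (X : MergeConvertibleCode F (kI + rI) kI (ς * kI + rF) ς 1), X.IsAccessOptimal →
        (X.bandwidth : ℚ) = mergeBandwidthBound kI rI rF ς 1) ∧
    -- the bound holds for all parameters and is tight for all parameters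
    (∀ (α : ℕ) (F : Type) [Field F] [Finite F]
      (X : MergeConvertibleCode F (kI + rI) kI (ς * kI + rF) ς α), X.IsMDS →
      mergeBandwidthBound kI rI rF ς α ≤ (X.bandwidth : ℚ)) ∧
    (∃ α : ℕ, 1 ≤ α ∧ (rI < rF → rF < kI → α = rF) ∧
      ∃ (F : Type) (_ : Field F) (_ : Finite F)
        (X : MergeConvertibleCode F (kI + rI) kI (ς * kI + rF) ς α), X.IsMDS ∧
        (X.bandwidth : ℚ) = mergeBandwidthBound kI rI rF ς α) := by

  refine ⟨fun h hr F _ _ B hB => MergeConvertibleCode.exists_piggyback hk hς h hr B hB,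
    fun h hr p D hp hD F _ _ hF θ hθ =>
      MergeConvertibleCode.exists_isBase_vandermonde hk hς hr hp hD hF θ hθ,
    fun h => ?_, fun α F _ _ X hX => X.mergeBandwidthBound_le_bandwidth hX.2 hk hς, ?_⟩
  · obtain ⟨K, _, _, Y, hY, hb⟩ := MergeConvertibleCode.exists_scalar_bandwidth_eq hk hς h
    refine ⟨⟨K, _, inferInstance, Y, Y.isAccessOptimal_of_bandwidth_eq hY hk hς hb⟩,
      fun F _ _ X hX => le_antisymm ?_ (X.mergeBandwidthBound_le_bandwidth hX.1.2 hk hς)⟩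
    have hle := hX.2 K Y hY
    rw [← MergeConvertibleCode.bandwidth_eq_accessCost,
      ← MergeConvertibleCode.bandwidth_eq_accessCost] at hle
    rw [← hb]
    exact_mod_cast hle
  · by_cases h : rF ≤ rI ∨ kI ≤ rF
    · obtain ⟨F, _, _, X, hX, hb⟩ := MergeConvertibleCode.exists_scalar_bandwidth_eq hk hς h
      exact ⟨1, le_rfl, fun h1 h2 => by omega, F, _, inferInstance, X, hX, hb⟩
    · push Not at h
      obtain ⟨F, _, _, θ, hF, hθ⟩ := exists_field_card_eq_two_pow (ς * kI * rF ^ 2)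
      obtain ⟨B, -, -, -, hB⟩ := MergeConvertibleCode.exists_isBase_vandermonde hk hς h.2
        Nat.prime_two (Nat.le_succ _) hF θ hθ
      obtain ⟨X, -, -, -, hX, -, -, -, hb⟩ :=
        MergeConvertibleCode.exists_piggyback hk hς h.1 h.2 B hB
      exact ⟨rF, by omega, fun _ _ => rfl, F, _, inferInstance, X, hX, hb⟩
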